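/- **Theorem.** Let $\alpha_0,\dots,\alpha_8\in\mathbb C$ be constants such that the five numbers $\alpha_1,\ \alpha_1+\alpha_2,\ \dots,\ \alpha_1+\alpha_2+\alpha_3+\alpha_4+\alpha_5$ are pairwise distinct and $\alpha_7\neq 0$ (so that the coordinate systems below are pairwise distinct). For $I\in\mathbb C(t)[q,p]$ consider the Hamiltonian system $$\frac{dq}{dt}=\frac{\partial I}{\partial p},\qquad \frac{dp}{dt}=-\frac{\partial I}{\partial q}.$$ Say that it is a polynomial Hamiltonian system in coordinates $(x,y)$ (rational functions of $q,p$) if there is $H\in\mathbb C(t)[x,y]$ such that it reads $dx/dt=\partial H/\partial y$, $dy/dt=-\partial H/\partial x$. Let $$r_0:\ x_0=\tfrac1q,\quad y_0=-(qp+\alpha_0)q,$$ $$r_i:\ x_i=-\bigl(pq-(\alpha_1+\dots+\alpha_i)\bigr)p,\quad y_i=\tfrac1p\qquad(i=1,\dots,5),$$ $$r_6:\ x_6=-\bigl(p(q-1)-\alpha_6\bigr)p,\quad y_6=\tfrac1p,\qquad r_7:\ x_7=-\bigl(p(q-1)-(\alpha_6+\alpha_7)\bigr)p,\quad y_7=\tfrac1p,$$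 $$r_8:\ x_8=-(x_0y_0-\alpha_8)y_0,\quad y_8=\tfrac1{y_0}.$$ Then the following are equivalent. 1. $I$ has total degree $15$ in $(q,p)$, and the system is a polynomial Hamiltonian system in each of the coordinates $r_0,r_1,\dots,r_8$. 2. $6\alpha_0+5\alpha_1+4\alpha_2+3\alpha_3+2\alpha_4+\alpha_5+4\alpha_6+2\alpha_7+3\alpha_8=0$, and $I=c(t)\,I_0+d(t)$ for some $c,d\in\mathbb C(t)$ with $c\neq0$. In particular, if the coefficient of $q^9p^6$ in $I$ is normalized to be $1$, then the system coincides with the Hamiltonian system of $I_0$. Here $I_0$ is the following polynomial. Put $\sigma=2\alpha_0+\alpha_8$, $m=\alpha_0(\alpha_0+\alpha_8)$, $s=2\alpha_6+\alpha_7$, $n=\alpha_6(\alpha_6+\alpha_7)$, let $e_k$ be the $k$-th elementary symmetric function of $\alpha_1,\ \alpha_1+\alpha_2,\ \dots,\ \alpha_1+\dots+\alpha_5$, and put $$a=3\sigma^2+4\sigma s-m+s^2+2n-e_2,$$ $$\begin{aligned}b={}&-2\sigma^4-7\sigma^3s-3\sigma^2m-9\sigma^2s^2+3\sigma^2n+\sigma^2e_2-4\sigma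 ms-5\sigma s^3+4\sigma sn+2\sigma se_2+\sigma e_3\\&-ms^2-mn+me_2-s^4+s^2n+s^2e_2+se_3+n^2-ne_2+e_4,\end{aligned}$$ $$c'=-4\sigma^3-6\sigma^2s+3\sigma m-2\sigma s^2-4\sigma n+\sigma e_2+2ms-2sn-e_3,\qquad d'=-3\sigma^2-6\sigma s+3m-2s^2-4n+3e_2,$$ $$c_{41}=s^2+2n-e_2-3\sigma^2-3m,$$ $$c_{33}=\sigma^3+6\sigma m,\quad c_{32}=2\sigma a-3\sigma^3-2\sigma^2s-10\sigma m-4ms,\quad c_{31}=-2sn-e_3-c_{32}-c_{33},$$ $$c_{24}=3\sigma^2m+3m^2,\quad c_{23}=(\sigma^2+2m)a-8\sigma^2m-4\sigma ms-4m^2,\quad c_{22}=b+\sigma c'+md',\quad c_{21}=n^2-e_4-c_{22}-c_{23}-c_{24},$$ $$c_{14}=3\sigma m^2,\quad c_{13}=2\sigma ma-(4\sigma+2s)m^2,\quad c_{12}=\sigma b+mc',$$ $$c_{11}=n\,(5\sigma^3+9\sigma^2s+5\sigma s^2+\sigma n-2\sigma e_2-ms+s^3-se_2-e_3)+e_5-c_{12}-c_{13}-c_{14}.$$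 Then $$\begin{aligned} I_0={}&p^6(q-1)^4q^5+p^5(q-1)^3q^4\bigl(-(3\sigma+2s)+3\sigma q\bigr)+p^4(q-1)^2q^3\bigl(e_2+c_{41}q+3(\sigma^2+m)q^2\bigr)\\ &+p^3(q-1)q^2\bigl(e_3+c_{31}q+c_{32}q^2+c_{33}q^3\bigr)+p^2q\bigl(e_4+c_{21}q+c_{22}q^2+c_{23}q^3+c_{24}q^4\bigr)\\ &+p\bigl(-e_5+c_{11}q+c_{12}q^2+c_{13}q^3+c_{14}q^4\bigr)+q\,m\,\bigl(b+am\,q+m^2q^2\bigr). \end{aligned}$$ -/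

import Mathlib

/-- `ℂ(t)[q, p]`, with `q = X 0` and `p = X 1`. -/
abbrev PhasePoly : Type := MvPolynomial (Fin 2) (RatFunc ℂ)

/-- `ℂ(t)(q, p)`. -/
abbrev PhaseField : Type := FractionRing PhasePoly

namespace PhaseField

/-- The function `q`. -/
noncomputable def q : PhaseField := algebraMap PhasePoly PhaseField (MvPolynomial.X 0)

/-- The function `p`. -/
noncomputable def p : PhaseField := algebraMap PhasePoly PhaseField (MvPolynomial.X 1)

/-- A complex number as a constant function. -/
noncomputable def const (c : ℂ) : PhaseField := algebraMap (RatFunc ℂ) PhaseField (RatFunc.C c)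

/-- The partial derivative `∂f/∂q` (`i = 0`) or `∂f/∂p` (`i = 1`) of a rational function `f`,
by the quotient rule applied to its reduced fraction. -/
noncomputable def partialDeriv (i : Fin 2) (f : PhaseField) : PhaseField :=
  let a : PhasePoly := IsFractionRing.num PhasePoly f
  let b : PhasePoly := (IsFractionRing.den PhasePoly f : PhasePoly)
  algebraMap PhasePoly PhaseField (MvPolynomial.pderiv i a * b - a * MvPolynomial.pderiv i b) /
    algebraMap PhasePoly PhaseField b ^ 2

/-- The quotient rule holds for every fraction that represents `f`. -/
theorem partialDeriv_div (i : Fin 2) (a b : PhasePoly) (hb : b ≠ 0) :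
    partialDeriv i (algebraMap PhasePoly PhaseField a / algebraMap PhasePoly PhaseField b) =
      algebraMap PhasePoly PhaseField
          (MvPolynomial.pderiv i a * b - a * MvPolynomial.pderiv i b) /
        algebraMap PhasePoly PhaseField b ^ 2 := by
  have inj := IsFractionRing.injective PhasePoly PhaseField
  set f := algebraMap PhasePoly PhaseField a / algebraMap PhasePoly PhaseField b with hf
  have hb' : algebraMap PhasePoly PhaseField b ≠ 0 :=
    (map_ne_zero_iff _ inj).2 hb
  have hd : (IsFractionRing.den PhasePoly f : PhasePoly) ≠ 0 :=
    nonZeroDivisors.ne_zero (IsFractionRing.den PhasePoly f).2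
  have hd' : algebraMap PhasePoly PhaseField (IsFractionRing.den PhasePoly f : PhasePoly) ≠ 0 :=
    (map_ne_zero_iff _ inj).2 hd
  have h1 : algebraMap PhasePoly PhaseField (IsFractionRing.num PhasePoly f) /
      algebraMap PhasePoly PhaseField (IsFractionRing.den PhasePoly f : PhasePoly) = f :=
    IsFractionRing.mk'_num_den' PhasePoly f
  unfold partialDeriv
  generalize IsFractionRing.num PhasePoly f = c at *
  generalize (IsFractionRing.den PhasePoly f : PhasePoly) = d at *
  have h2 : c * b = a * d := by
    apply inj
    rw [hf, div_eq_div_iff hd' hb'] at h1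
    simpa using h1
  have h3 : MvPolynomial.pderiv i c * b + c * MvPolynomial.pderiv i b =
      MvPolynomial.pderiv i a * d + a * MvPolynomial.pderiv i d := by
    have := congrArg (MvPolynomial.pderiv i) h2
    simp only [Derivation.leibniz, smul_eq_mul] at this
    linear_combination this
  rw [div_eq_div_iff (pow_ne_zero 2 hd') (pow_ne_zero 2 hb'), ← map_pow, ← map_pow, ← map_mul,
    ← map_mul]
  congr 1
  linear_combination (b * d) * h3 - (MvPolynomial.pderiv i b * d + b * MvPolynomial.pderiv i d) * h2

/-- The derivative of `f` along the Hamiltonian system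
`dq/dt = ∂I/∂p`, `dp/dt = -∂I/∂q`, for `f` that does not depend explicitly on `t`
(all coordinates below are of this kind):
`df/dt = (∂f/∂q) (∂I/∂p) - (∂f/∂p) (∂I/∂q)`. -/
noncomputable def timeDeriv (I : PhasePoly) (f : PhaseField) : PhaseField :=
  partialDeriv 0 f * algebraMap PhasePoly PhaseField (MvPolynomial.pderiv 1 I) -
    partialDeriv 1 f * algebraMap PhasePoly PhaseField (MvPolynomial.pderiv 0 I)

/-- In the coordinates `(x, y)` the Hamiltonian system of `I` is again a polynomial Hamiltonian
system: there is `H ∈ ℂ(t)[X, Y]` with `dx/dt = (∂H/∂Y)(x, y)` and `dy/dt = -(∂H/∂X)(x, y)`. -/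
def IsPolynomialHamiltonianIn (I : PhasePoly) (xy : PhaseField × PhaseField) : Prop :=
  ∃ H : PhasePoly,
    timeDeriv I xy.1 = MvPolynomial.aeval ![xy.1, xy.2] (MvPolynomial.pderiv 1 H) ∧
    timeDeriv I xy.2 = -MvPolynomial.aeval ![xy.1, xy.2] (MvPolynomial.pderiv 0 H)

/-- From coordinates `(u, v)` to `(-(u v - c) v, 1 / v)`. -/
noncomputable def blowUpChart (uv : PhaseField × PhaseField) (c : ℂ) : PhaseField × PhaseField :=
  (-(uv.1 * uv.2 - const c) * uv.2, 1 / uv.2)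

/-- `r₀ : (x₀, y₀) = (1 / q, -(q p + α₀) q)`. -/
noncomputable def chartZero (α : Fin 9 → ℂ) : PhaseField × PhaseField :=
  (1 / q, -(q * p + const (α 0)) * q)

/-- The coordinates `r₀, …, r₈`; the last one is taken relative to `(x₀, y₀)`. -/
noncomputable def chart (α : Fin 9 → ℂ) : Fin 9 → PhaseField × PhaseField :=
  ![chartZero α,
    blowUpChart (q, p) (α 1),
    blowUpChart (q, p) (α 1 + α 2),
    blowUpChart (q, p) (α 1 + α 2 + α 3),
    blowUpChart (q, p) (α 1 + α 2 + α 3 + α 4),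
    blowUpChart (q, p) (α 1 + α 2 + α 3 + α 4 + α 5),
    blowUpChart (q - 1, p) (α 6),
    blowUpChart (q - 1, p) (α 6 + α 7),
    blowUpChart (chartZero α) (α 8)]

end PhaseField

/-- The numbers `α₁, α₁ + α₂, …, α₁ + ⋯ + α₅`. -/
def partialSums {A : Type*} [CommRing A] (α : Fin 9 → A) : Fin 5 → A :=
  ![α 1, α 1 + α 2, α 1 + α 2 + α 3, α 1 + α 2 + α 3 + α 4, α 1 + α 2 + α 3 + α 4 + α 5]

/-- The `k`-th elementary symmetric function of `α₁, α₁ + α₂, …, α₁ + ⋯ + α₅`. -/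
def elemSym {A : Type*} [CommRing A] (α : Fin 9 → A) (k : ℕ) : A :=
  ∑ S ∈ (Finset.univ : Finset (Fin 5)).powersetCard k, ∏ j ∈ S, partialSums α j

/-- The explicit Hamiltonian with parameters `α₀, …, α₈`, as an expression in `q` and `p`.
It is arranged by powers of `p`; the coefficients are polynomials in `α₀, …, α₈`. -/
def e8Hamiltonian {A : Type*} [CommRing A] (α : Fin 9 → A) (q p : A) : A :=
  let σ : A := 2 * α 0 + α 8
  let m : A := α 0 * (α 0 + α 8)
  let s : A := 2 * α 6 + α 7
  let n : A := α 6 * (α 6 + α 7)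
  let e₂ : A := elemSym α 2
  let e₃ : A := elemSym α 3
  let e₄ : A := elemSym α 4
  let e₅ : A := elemSym α 5
  let a : A := 3 * σ ^ 2 + 4 * σ * s - m + s ^ 2 + 2 * n - e₂
  let b : A :=
    -2 * σ ^ 4 - 7 * σ ^ 3 * s - 3 * σ ^ 2 * m - 9 * σ ^ 2 * s ^ 2 + 3 * σ ^ 2 * n + σ ^ 2 * e₂
      - 4 * σ * m * s - 5 * σ * s ^ 3 + 4 * σ * s * n + 2 * σ * s * e₂ + σ * e₃ - m * s ^ 2
      - m * n + m * e₂ - s ^ 4 + s ^ 2 * n + s ^ 2 * e₂ + s * e₃ + n ^ 2 - n * e₂ + e₄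
  let c : A :=
    -4 * σ ^ 3 - 6 * σ ^ 2 * s + 3 * σ * m - 2 * σ * s ^ 2 - 4 * σ * n + σ * e₂ + 2 * m * s
      - 2 * s * n - e₃
  let d : A := -3 * σ ^ 2 - 6 * σ * s + 3 * m - 2 * s ^ 2 - 4 * n + 3 * e₂
  let c₄₁ : A := s ^ 2 + 2 * n - e₂ - 3 * σ ^ 2 - 3 * m
  let c₃₃ : A := σ ^ 3 + 6 * σ * m
  let c₃₂ : A := 2 * σ * a - 3 * σ ^ 3 - 2 * σ ^ 2 * s - 10 * σ * m - 4 * m * s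
  let c₃₁ : A := -(2 * s * n) - e₃ - c₃₂ - c₃₃
  let c₂₄ : A := 3 * σ ^ 2 * m + 3 * m ^ 2
  let c₂₃ : A := (σ ^ 2 + 2 * m) * a - 8 * σ ^ 2 * m - 4 * σ * m * s - 4 * m ^ 2
  let c₂₂ : A := b + σ * c + m * d
  let c₂₁ : A := n ^ 2 - e₄ - c₂₂ - c₂₃ - c₂₄
  let c₁₄ : A := 3 * σ * m ^ 2
  let c₁₃ : A := 2 * σ * m * a - (4 * σ + 2 * s) * m ^ 2
  let c₁₂ : A := σ * b + m * c
  let c₁₁ : A :=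
    n * (5 * σ ^ 3 + 9 * σ ^ 2 * s + 5 * σ * s ^ 2 + σ * n - 2 * σ * e₂ - m * s + s ^ 3 - s * e₂
      - e₃) + e₅ - c₁₂ - c₁₃ - c₁₄
  p ^ 6 * (q - 1) ^ 4 * q ^ 5
    + p ^ 5 * (q - 1) ^ 3 * q ^ 4 * (-(3 * σ + 2 * s) + 3 * σ * q)
    + p ^ 4 * (q - 1) ^ 2 * q ^ 3 * (e₂ + c₄₁ * q + 3 * (σ ^ 2 + m) * q ^ 2)
    + p ^ 3 * (q - 1) * q ^ 2 * (e₃ + c₃₁ * q + c₃₂ * q ^ 2 + c₃₃ * q ^ 3)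
    + p ^ 2 * q * (e₄ + c₂₁ * q + c₂₂ * q ^ 2 + c₂₃ * q ^ 3 + c₂₄ * q ^ 4)
    + p * (-e₅ + c₁₁ * q + c₁₂ * q ^ 2 + c₁₃ * q ^ 3 + c₁₄ * q ^ 4)
    + q * m * (b + a * m * q + m ^ 2 * q ^ 2)

/-!
The coordinates of every chart are canonical (their Poisson bracket is `1`), so the system is
polynomial Hamiltonian in a chart exactly when `I` itself is a polynomial in the coordinates of that
chart (`isPolynomialHamiltonianIn_iff`): the two Hamiltonians have the same partial derivatives, and
a rational function with vanishing partial derivatives is a constant.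

For the chart `x = -(u v - c) v`, `y = 1 / v`, regularity of `I = ∑ I_{a, b} uᵃ vᵇ` is a condition on
diagonals: `(X - c) ^ w` divides `∑ₐ I_{a, a + w} Xᵃ` for all `w ≥ 0` (`dvd_diag_of_blowUp`). The
charts `r₁, …, r₅` give divisibility by `P ^ w`, where `P` has degree `5` and roots
`α₁, …, α₁ + ⋯ + α₅`; the charts `r₀`, `r₈` together give, for the diagonals on the side of `q`,
divisibility by `A ^ w` with `A = (X + α₀) (X + α₀ + α₈)` (`dvd_diag_of_blowUp_blowUp`); and `r₆`,
`r₇` give, for the diagonals of `I(q + 1, p)`, divisibility by `B ^ w` with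
`B = (X - α₆) (X - α₆ - α₇)`.

In degree at most `15`, a diagonal that is shorter than the power dividing it vanishes. Together with
the zeros which this imposes on each row `∑ₐ I_{a, b} qᵃ` at `q = 0`, at `q = 1` and on its degree, a
descent on the power `b` of `p` shows that an `I` without the monomial `q⁹ p⁶` is constant
(`IsAdmissible.eq_C`). If the coefficient of `q⁹ p⁶` is `c`, the rows of `p⁶` and `p⁵` are determined,
and the row of `p⁵` is overdetermined: three second-highest coefficients, those of `P`, `A ^ 3` and
`B ^ 2`, have to match. This is the linear relation between the parameters
(`IsAdmissible.coeffAt_mul_eq_zero`).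

Conversely, under the relation the explicit Hamiltonian can be written as a polynomial in
`z = q p` and `q A(z)` plus `p P(z)`, and also as a polynomial in `u = q - 1`, `u p` and `p B(u p)`;
these building blocks are visibly regular in the respective charts
(`e8Hamiltonian_mem_regularFunctions`). Its coefficient of `q⁹ p⁶` is `1`, so subtracting a multiple
of it from `I` leaves a constant.
-/

/-! ### Rational functions in two variables as a Poisson algebra -/

namespace MvPolynomial

theorem totalDegree_pderiv_lt {σ R : Type*} [CommSemiring R] (i : σ) {f : MvPolynomial σ R}
    (h : pderiv i f ≠ 0) : (pderiv i f).totalDegree < f.totalDegree := by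
  classical
  obtain ⟨m, hm, hdeg⟩ : ∃ m ∈ (pderiv i f).support,
      (pderiv i f).totalDegree = m.sum fun _ e => e := by
    obtain ⟨m, hm, h'⟩ := Finset.exists_mem_eq_sup (pderiv i f).support
      (MvPolynomial.support_nonempty.2 h) (fun m => m.sum fun _ e => e)
    exact ⟨m, hm, h'⟩
  rw [mem_support_iff, coeff_pderiv] at hm
  have h1 : m + Finsupp.single i 1 ∈ f.support :=
    mem_support_iff.2 fun h0 => hm (by rw [h0, zero_mul])
  have h2 := le_totalDegree h1
  rw [Finsupp.sum_add_index' (by simp) (by simp), Finsupp.sum_single_index rfl] at h2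
  omega

theorem eq_C_of_forall_pderiv_eq_zero {σ R : Type*} [CommRing R] [IsDomain R] [CharZero R]
    {f : MvPolynomial σ R} (h : ∀ i, pderiv i f = 0) : f = C (coeff 0 f) := by
  classical
  ext m
  rw [coeff_C]
  split_ifs with hm
  · rw [hm]
  obtain ⟨i, hi⟩ := Finsupp.ne_iff.1 (Ne.symm hm)
  have h1 := congrArg (coeff (m - Finsupp.single i 1)) (h i)
  have h2 : m - Finsupp.single i 1 + Finsupp.single i 1 = m := by
    apply tsub_add_cancel_of_le
    simpa [Nat.one_le_iff_ne_zero] using hi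
  rw [coeff_pderiv, h2, coeff_zero, mul_eq_zero] at h1
  exact h1.resolve_right (Nat.cast_add_one_ne_zero _)

end MvPolynomial

/-- The chain rule for a derivation and a polynomial expression in two elements. -/
theorem Derivation.leibniz_aeval_fin_two {K F : Type*} [CommRing K] [CommRing F] [Algebra K F]
    (D : Derivation K F F) (x y : F) (H : MvPolynomial (Fin 2) K) :
    D (MvPolynomial.aeval ![x, y] H) =
      MvPolynomial.aeval ![x, y] (MvPolynomial.pderiv 0 H) * D x +
        MvPolynomial.aeval ![x, y] (MvPolynomial.pderiv 1 H) * D y := by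
  induction H using MvPolynomial.induction_on with
  | C a => simp
  | add f g hf hg => simp only [map_add, hf, hg]; ring
  | mul_X f i hf =>
    simp only [map_mul, Derivation.leibniz, hf, smul_eq_mul, map_add, MvPolynomial.aeval_X]
    fin_cases i <;> simp [MvPolynomial.pderiv_X] <;> ring

namespace PhaseField

open MvPolynomial (pderiv aeval)

theorem partialDeriv_algebraMap (i : Fin 2) (a : PhasePoly) :
    partialDeriv i (algebraMap PhasePoly PhaseField a) =
      algebraMap PhasePoly PhaseField (pderiv i a) := by
  simpa using partialDeriv_div i a 1 one_ne_zero

theorem exists_eq_div (f : PhaseField) : ∃ a b : PhasePoly, b ≠ 0 ∧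
    f = algebraMap PhasePoly PhaseField a / algebraMap PhasePoly PhaseField b := by
  obtain ⟨a, b, hb, h⟩ := IsFractionRing.div_surjective (A := PhasePoly) f
  exact ⟨a, b, nonZeroDivisors.ne_zero hb, h.symm⟩

theorem algebraMap_ne_zero {b : PhasePoly} (hb : b ≠ 0) : algebraMap PhasePoly PhaseField b ≠ 0 :=
  (map_ne_zero_iff _ (IsFractionRing.injective PhasePoly PhaseField)).2 hb

theorem partialDeriv_add (i : Fin 2) (f g : PhaseField) :
    partialDeriv i (f + g) = partialDeriv i f + partialDeriv i g := by
  obtain ⟨a, b, hb, rfl⟩ := exists_eq_div f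
  obtain ⟨c, d, hd, rfl⟩ := exists_eq_div g
  have hb' := algebraMap_ne_zero hb
  have hd' := algebraMap_ne_zero hd
  rw [div_add_div _ _ hb' hd', ← map_mul, ← map_mul, ← map_mul, ← map_add,
    partialDeriv_div i _ _ (mul_ne_zero hb hd), partialDeriv_div i _ _ hb,
    partialDeriv_div i _ _ hd]
  simp only [map_add, map_sub, map_mul, Derivation.leibniz, smul_eq_mul]
  field_simp
  ring

theorem partialDeriv_mul (i : Fin 2) (f g : PhaseField) :
    partialDeriv i (f * g) = f * partialDeriv i g + g * partialDeriv i f := by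
  obtain ⟨a, b, hb, rfl⟩ := exists_eq_div f
  obtain ⟨c, d, hd, rfl⟩ := exists_eq_div g
  have hb' := algebraMap_ne_zero hb
  have hd' := algebraMap_ne_zero hd
  rw [div_mul_div_comm, ← map_mul, ← map_mul,
    partialDeriv_div i _ _ (mul_ne_zero hb hd), partialDeriv_div i _ _ hb,
    partialDeriv_div i _ _ hd]
  simp only [map_add, map_sub, map_mul, Derivation.leibniz, smul_eq_mul]
  field_simp
  ring

theorem algebraMap_eq (c : RatFunc ℂ) :
    algebraMap (RatFunc ℂ) PhaseField c = algebraMap PhasePoly PhaseField (MvPolynomial.C c) :=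
  IsScalarTower.algebraMap_apply (RatFunc ℂ) PhasePoly PhaseField c

/-- `partialDeriv i` as a derivation over `ℂ(t)`. -/
noncomputable def partialDerivation (i : Fin 2) : Derivation (RatFunc ℂ) PhaseField PhaseField :=
  Derivation.mk'
    { toFun := partialDeriv i
      map_add' := partialDeriv_add i
      map_smul' := fun c f => by
        rw [Algebra.smul_def, partialDeriv_mul, algebraMap_eq, partialDeriv_algebraMap,
          MvPolynomial.pderiv_C, map_zero, mul_zero, add_zero, RingHom.id_apply, ← algebraMap_eq,
          ← Algebra.smul_def] }
    (partialDeriv_mul i)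

theorem partialDerivation_apply (i : Fin 2) (f : PhaseField) :
    partialDerivation i f = partialDeriv i f := rfl

/-- A rational function with vanishing partial derivatives is a constant: in a reduced fraction
the denominator would divide its own derivatives, which have smaller degree. -/
theorem exists_eq_algebraMap_of_partialDeriv_eq_zero {f : PhaseField}
    (h : ∀ i, partialDeriv i f = 0) : ∃ c : RatFunc ℂ, f = algebraMap (RatFunc ℂ) PhaseField c := by
  have hf := IsFractionRing.mk'_num_den' PhasePoly f
  have hrel := IsFractionRing.num_den_reduced PhasePoly f
  have hb : (IsFractionRing.den PhasePoly f : PhasePoly) ≠ 0 :=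
    nonZeroDivisors.ne_zero (IsFractionRing.den PhasePoly f).2
  generalize IsFractionRing.num PhasePoly f = a at *
  generalize (IsFractionRing.den PhasePoly f : PhasePoly) = b at *
  have h1 : ∀ i, pderiv i a * b = a * pderiv i b := fun i => by
    have h2 := h i
    rw [← hf, partialDeriv_div i a b hb, div_eq_zero_iff] at h2
    have h3 := h2.resolve_right (pow_ne_zero 2 (algebraMap_ne_zero hb))
    exact sub_eq_zero.1 ((map_eq_zero_iff _ (IsFractionRing.injective PhasePoly PhaseField)).1 h3)
  have h2 : ∀ i, pderiv i b = 0 := fun i => by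
    by_contra h3
    obtain ⟨e, he⟩ : b ∣ pderiv i b :=
      hrel.symm.dvd_of_dvd_mul_left ⟨_, (h1 i).symm.trans (mul_comm _ _)⟩
    have he0 : e ≠ 0 := by rintro rfl; exact h3 (by rw [he, mul_zero])
    have h4 := MvPolynomial.totalDegree_mul_of_isDomain hb he0
    have h5 := MvPolynomial.totalDegree_pderiv_lt i h3
    rw [← he] at h4
    omega
  have h3 : ∀ i, pderiv i a = 0 := fun i => by
    have := h1 i
    rw [h2 i, mul_zero] at this
    exact (mul_eq_zero.1 this).resolve_right hb
  refine ⟨MvPolynomial.coeff 0 a / MvPolynomial.coeff 0 b, ?_⟩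
  rw [← hf, map_div₀, algebraMap_eq, algebraMap_eq,
    ← MvPolynomial.eq_C_of_forall_pderiv_eq_zero h2,
    ← MvPolynomial.eq_C_of_forall_pderiv_eq_zero h3]

/-- The Poisson bracket `{f, g} = (∂f/∂q) (∂g/∂p) - (∂f/∂p) (∂g/∂q)`. -/
noncomputable def bracket (f g : PhaseField) : PhaseField :=
  partialDerivation 0 f * partialDerivation 1 g - partialDerivation 1 f * partialDerivation 0 g

theorem timeDeriv_eq_bracket (I : PhasePoly) (f : PhaseField) :
    timeDeriv I f = bracket f (algebraMap PhasePoly PhaseField I) := by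
  simp only [timeDeriv, bracket, partialDerivation_apply, partialDeriv_algebraMap]

/-- The Jacobian criterion: elements with nonvanishing bracket are algebraically independent. -/
theorem aeval_injective_of_bracket_ne_zero {x y : PhaseField} (hxy : bracket x y ≠ 0) :
    Function.Injective (aeval ![x, y] : PhasePoly →ₐ[RatFunc ℂ] PhaseField) := by
  rw [injective_iff_map_eq_zero]
  intro H
  induction hn : H.totalDegree using Nat.strong_induction_on generalizing H with
  | _ n ih =>
    intro hH
    have hD : ∀ i, aeval ![x, y] (pderiv 0 H) * partialDerivation i x +
        aeval ![x, y] (pderiv 1 H) * partialDerivation i y = 0 := fun i => by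
      rw [← Derivation.leibniz_aeval_fin_two, hH, map_zero]
    have h0 : aeval ![x, y] (pderiv 0 H) = 0 := by
      refine (mul_eq_zero.1 ?_).resolve_right hxy
      simp only [bracket]
      linear_combination partialDerivation 1 y * hD 0 - partialDerivation 0 y * hD 1
    have h1 : aeval ![x, y] (pderiv 1 H) = 0 := by
      refine (mul_eq_zero.1 ?_).resolve_right hxy
      simp only [bracket]
      linear_combination partialDerivation 0 x * hD 1 - partialDerivation 1 x * hD 0
    have hz : ∀ i, aeval ![x, y] (pderiv i H) = 0 := by
      intro i
      fin_cases i
      · exact h0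
      · exact h1
    have hp : ∀ i, pderiv i H = 0 := fun i => by
      by_contra h3
      exact h3 (ih _ (hn ▸ MvPolynomial.totalDegree_pderiv_lt i h3) _ rfl (hz i))
    have hC := MvPolynomial.eq_C_of_forall_pderiv_eq_zero hp
    rw [hC, MvPolynomial.aeval_C] at hH
    rw [hC, (map_eq_zero_iff _ (algebraMap (RatFunc ℂ) PhaseField).injective).1 hH, map_zero]

/-- In canonical coordinates `(x, y)` the system is polynomial Hamiltonian exactly when `I` itself
is a polynomial in `x` and `y`. -/
theorem isPolynomialHamiltonianIn_iff {x y : PhaseField} (hxy : bracket x y = 1) (I : PhasePoly) :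
    IsPolynomialHamiltonianIn I (x, y) ↔
      ∃ H : PhasePoly, aeval ![x, y] H = algebraMap PhasePoly PhaseField I := by
  have key : ∀ H : PhasePoly,
      bracket x (aeval ![x, y] H) = aeval ![x, y] (pderiv 1 H) ∧
        bracket y (aeval ![x, y] H) = -aeval ![x, y] (pderiv 0 H) := fun H => by
    simp only [bracket] at hxy
    simp only [bracket, Derivation.leibniz_aeval_fin_two]
    constructor
    · linear_combination aeval ![x, y] (pderiv 1 H) * hxy
    · linear_combination -aeval ![x, y] (pderiv 0 H) * hxy
  constructor
  · rintro ⟨H, h1, h2⟩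
    simp only [timeDeriv_eq_bracket, ← (key H).1, ← (key H).2] at h1 h2
    set G := algebraMap PhasePoly PhaseField I - aeval ![x, y] H with hG
    simp only [bracket] at hxy h1 h2
    have hG0 : partialDerivation 0 G = 0 := by
      rw [hG, map_sub]
      linear_combination (-(partialDerivation 0 (algebraMap PhasePoly PhaseField I)) +
        partialDerivation 0 (aeval ![x, y] H)) * hxy + partialDerivation 0 y * h1 -
        partialDerivation 0 x * h2
    have hG1 : partialDerivation 1 G = 0 := by
      rw [hG, map_sub]
      linear_combination (-(partialDerivation 1 (algebraMap PhasePoly PhaseField I)) +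
        partialDerivation 1 (aeval ![x, y] H)) * hxy + partialDerivation 1 y * h1 -
        partialDerivation 1 x * h2
    obtain ⟨c, hc⟩ := exists_eq_algebraMap_of_partialDeriv_eq_zero (f := G) (fun i => by
      fin_cases i
      · exact hG0
      · exact hG1)
    refine ⟨H + MvPolynomial.C c, ?_⟩
    rw [map_add, MvPolynomial.aeval_C, ← hc, hG]
    ring
  · rintro ⟨H, hH⟩
    exact ⟨H, by rw [timeDeriv_eq_bracket, ← hH, (key H).1],
      by rw [timeDeriv_eq_bracket, ← hH, (key H).2]⟩

theorem bracket_swap (f g : PhaseField) : bracket g f = -bracket f g := by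
  simp only [bracket]
  ring

theorem bracket_blowUpChart {u v : PhaseField} (hv : v ≠ 0) (c : ℂ) :
    bracket (blowUpChart (u, v) c).1 (blowUpChart (u, v) c).2 = bracket u v := by
  have hc : ∀ i, partialDerivation i (const c) = 0 := fun i => Derivation.map_algebraMap _ _
  simp only [bracket, blowUpChart, one_div, Derivation.leibniz, map_neg, map_sub, hc, smul_eq_mul,
    Derivation.leibniz_inv]
  field_simp
  ring

theorem bracket_q_p : bracket q p = 1 := by
  simp [bracket, q, p, partialDerivation_apply, partialDeriv_algebraMap, MvPolynomial.pderiv_X]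

theorem ne_zero_of_bracket_ne_zero {x y : PhaseField} (h : bracket x y ≠ 0) : y ≠ 0 := by
  rintro rfl
  simp [bracket] at h

end PhaseField

/-! ### Blow-ups and diagonals of polynomials in two variables -/

section BlowUp

open Polynomial (X C)
open LaurentPolynomial (T)

variable {K : Type*} [Field K]

theorem LaurentPolynomial.coeff_C_mul_T {R : Type*} [Semiring R] (a : R) (n k : ℤ) :
    (LaurentPolynomial.C a * T n).coeff k = if n = k then a else 0 := by
  classical
  rw [← LaurentPolynomial.single_eq_C_mul_T, AddMonoidAlgebra.coeff_single, Finsupp.single_apply]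

/-- The substitution `u = X T`, `v = T⁻¹`, which collects the monomials `uᵃ vᵇ` by the power
`T ^ (a - b)` and records `u v` as `X`. -/
noncomputable def diagHom (K : Type*) [Field K] :
    MvPolynomial (Fin 2) K →ₐ[K] LaurentPolynomial (Polynomial K) :=
  MvPolynomial.aeval ![LaurentPolynomial.C X * T 1, T (-1)]

/-- The chart `x = -(u v - c) v`, `y = v⁻¹` after the substitution `u = X T`, `v = T⁻¹`. -/
noncomputable def blowUpHom (c : K) :
    MvPolynomial (Fin 2) K →ₐ[K] LaurentPolynomial (Polynomial K) :=
  MvPolynomial.aeval ![LaurentPolynomial.C (C c - X) * T (-1), T 1]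

/-- The `w`-th diagonal `∑ₐ f_{a, a + w} Xᵃ` of a polynomial `f = ∑ f_{a, b} uᵃ vᵇ`. -/
noncomputable def diag (w : ℕ) (f : MvPolynomial (Fin 2) K) : Polynomial K :=
  (diagHom K f).coeff (-w)

/-- The coefficient of `uᵃ vᵇ`. -/
noncomputable def coeffAt (f : MvPolynomial (Fin 2) K) (a b : ℕ) : K :=
  f.coeff (Finsupp.single 0 a + Finsupp.single 1 b)

theorem exponent_eq_iff (m : Fin 2 →₀ ℕ) (a b : ℕ) :
    m = Finsupp.single 0 a + Finsupp.single 1 b ↔ m 0 = a ∧ m 1 = b := by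
  constructor
  · rintro rfl
    simp
  · rintro ⟨rfl, rfl⟩
    ext i
    fin_cases i <;> simp

theorem coeffAt_eq_zero_of_totalDegree_lt {f : MvPolynomial (Fin 2) K} {a b : ℕ}
    (h : f.totalDegree < a + b) : coeffAt f a b = 0 := by
  refine MvPolynomial.coeff_eq_zero_of_totalDegree_lt ?_
  change _ < (Finsupp.single (0 : Fin 2) a + Finsupp.single 1 b).sum fun _ e => e
  rwa [Finsupp.sum_add_index' (by simp) (by simp), Finsupp.sum_single_index rfl,
    Finsupp.sum_single_index rfl]

theorem coeffAt_monomial (m : Fin 2 →₀ ℕ) (r : K) (a b : ℕ) :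
    coeffAt (MvPolynomial.monomial m r) a b = if m 0 = a ∧ m 1 = b then r else 0 := by
  rw [coeffAt, MvPolynomial.coeff_monomial, if_congr (exponent_eq_iff m a b) rfl rfl]

theorem diagHom_monomial (m : Fin 2 →₀ ℕ) (r : K) :
    diagHom K (MvPolynomial.monomial m r) =
      LaurentPolynomial.C (C r * X ^ m 0) * T ((m 0 : ℤ) - m 1) := by
  rw [diagHom, MvPolynomial.aeval_monomial, Finsupp.prod_fintype _ _ (by simp), Fin.prod_univ_two]
  simp only [Matrix.cons_val_zero, Matrix.cons_val_one, mul_pow, LaurentPolynomial.T_pow,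
    LaurentPolynomial.algebraMap_apply, map_mul, map_pow, Polynomial.algebraMap_eq]
  rw [LaurentPolynomial.T_sub]
  simp only [mul_one, mul_neg]
  ring

theorem blowUpHom_monomial (c : K) (m : Fin 2 →₀ ℕ) (r : K) :
    blowUpHom c (MvPolynomial.monomial m r) =
      LaurentPolynomial.C (C r * (C c - X) ^ m 0) * T ((m 1 : ℤ) - m 0) := by
  rw [blowUpHom, MvPolynomial.aeval_monomial, Finsupp.prod_fintype _ _ (by simp),
    Fin.prod_univ_two]
  simp only [Matrix.cons_val_zero, Matrix.cons_val_one, mul_pow, LaurentPolynomial.T_pow,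
    LaurentPolynomial.algebraMap_apply, map_mul, map_pow, Polynomial.algebraMap_eq]
  rw [LaurentPolynomial.T_sub]
  simp only [mul_one, mul_neg]
  ring

theorem diag_add (w : ℕ) (f g : MvPolynomial (Fin 2) K) :
    diag w (f + g) = diag w f + diag w g := by
  rw [diag, map_add]
  rfl

theorem coeff_diag (w a : ℕ) (f : MvPolynomial (Fin 2) K) :
    (diag w f).coeff a = coeffAt f a (a + w) := by
  induction f using MvPolynomial.induction_on' with
  | monomial m r =>
    rw [diag, diagHom_monomial, LaurentPolynomial.coeff_C_mul_T, coeffAt_monomial, apply_ite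
      (fun P : Polynomial K => P.coeff a), Polynomial.coeff_C_mul_X_pow, Polynomial.coeff_zero]
    split_ifs <;> first | rfl | (exfalso; omega)
  | add f g hf hg =>
    rw [diag_add, Polynomial.coeff_add, hf, hg]
    rfl

/-- Polynomials in the chart `x = -(u v - c) v`, `y = v⁻¹` have divisible coefficients at negative
powers of `T`, since `T⁻¹` only enters through `x`. -/
theorem dvd_coeff_blowUpHom (c : K) (w : ℕ) (H : MvPolynomial (Fin 2) K) :
    (X - C c) ^ w ∣ (blowUpHom c H).coeff (-w) := by
  induction H using MvPolynomial.induction_on' with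
  | monomial m r =>
    rw [blowUpHom_monomial, LaurentPolynomial.coeff_C_mul_T]
    split_ifs with h
    · have h1 : X - C c ∣ C c - X := ⟨-1, by ring⟩
      exact ((pow_dvd_pow_of_dvd h1 w).trans (pow_dvd_pow _ (by omega))).mul_left _
    · exact dvd_zero _
  | add f g hf hg =>
    rw [map_add]
    exact dvd_add hf hg

/-- How the negative part of a polynomial in the chart depends on the diagonals of that polynomial
with its variables exchanged. -/
theorem coeff_blowUpHom_eq_comp (c : K) (w : ℕ) (H : MvPolynomial (Fin 2) K) :
    (blowUpHom c H).coeff (-w) =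
      (X ^ w * diag w (MvPolynomial.rename (Equiv.swap 0 1) H)).comp (C c - X) := by
  induction H using MvPolynomial.induction_on' with
  | monomial m r =>
    rw [blowUpHom_monomial, LaurentPolynomial.coeff_C_mul_T, MvPolynomial.rename_monomial, diag,
      diagHom_monomial, LaurentPolynomial.coeff_C_mul_T]
    have h0 : Finsupp.mapDomain (Equiv.swap (0 : Fin 2) 1) m 0 = m 1 := by
      conv_lhs => rw [← Equiv.swap_apply_right (0 : Fin 2) 1]
      exact Finsupp.mapDomain_apply (Equiv.injective _) _ _
    have h1 : Finsupp.mapDomain (Equiv.swap (0 : Fin 2) 1) m 1 = m 0 := by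
      conv_lhs => rw [← Equiv.swap_apply_left (0 : Fin 2) 1]
      exact Finsupp.mapDomain_apply (Equiv.injective _) _ _
    rw [h0, h1]
    split_ifs with h
    · have : m 0 = w + m 1 := by omega
      simp only [Polynomial.mul_comp, Polynomial.pow_comp, Polynomial.X_comp, Polynomial.C_comp,
        this, pow_add]
      ring
    · simp
  | add f g hf hg =>
    rw [map_add, map_add, diag_add, mul_add, Polynomial.add_comp, ← hf, ← hg]
    rfl

variable {F : Type*} [Field F] [Algebra K F]

/-- Clearing denominators in a polynomial of `x = -(u v - c) v` and `y = v⁻¹`. -/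
theorem exists_clear_denominator {u v : F} (hv : v ≠ 0) (c : K) (H : MvPolynomial (Fin 2) K) :
    ∃ (N : ℕ) (H' : MvPolynomial (Fin 2) K),
      v ^ N * MvPolynomial.aeval ![-(u * v - algebraMap K F c) * v, 1 / v] H =
        MvPolynomial.aeval ![u, v] H' ∧
      diagHom K H' = T (-N) * blowUpHom c H := by
  have hT : ∀ a b : ℤ, (T a * T b : LaurentPolynomial (Polynomial K)) = T (a + b) :=
    fun a b => (LaurentPolynomial.T_add a b).symm
  have hX0 : diagHom K (MvPolynomial.X 0) = LaurentPolynomial.C X * T 1 := by simp [diagHom]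
  have hX1 : diagHom K (MvPolynomial.X 1) = T (-1) := by simp [diagHom]
  have hY0 : blowUpHom c (MvPolynomial.X 0) = LaurentPolynomial.C (C c - X) * T (-1) := by
    simp [blowUpHom]
  have hY1 : blowUpHom c (MvPolynomial.X 1) = T 1 := by simp [blowUpHom]
  have hpow : ∀ n : ℕ, (T (-1) : LaurentPolynomial (Polynomial K)) ^ n = T (-n) := fun n => by
    rw [LaurentPolynomial.T_pow, mul_neg, mul_one]
  have hC : ∀ r : K, algebraMap K (LaurentPolynomial (Polynomial K)) r =
      LaurentPolynomial.C (C r) := fun r => rfl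
  induction H using MvPolynomial.induction_on with
  | C a =>
    refine ⟨0, MvPolynomial.C a, by simp, ?_⟩
    simp [diagHom, blowUpHom]
  | add f g hf hg =>
    obtain ⟨N, f', hf1, hf2⟩ := hf
    obtain ⟨M, g', hg1, hg2⟩ := hg
    refine ⟨N + M, MvPolynomial.X 1 ^ M * f' + MvPolynomial.X 1 ^ N * g', ?_, ?_⟩
    · simp only [map_add, map_mul, map_pow, MvPolynomial.aeval_X, Matrix.cons_val_one, ← hf1, ← hg1]
      simp only [Matrix.cons_val_fin_one]
      ring
    · simp only [map_add, map_mul, map_pow, hX1, hpow, hf2, hg2, ← mul_assoc, hT, mul_add]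
      push_cast
      rw [neg_add, add_comm (-(M : ℤ))]
  | mul_X f i hf =>
    obtain ⟨N, f', hf1, hf2⟩ := hf
    fin_cases i
    · refine ⟨N, f' * (-(MvPolynomial.X 0 * MvPolynomial.X 1 - MvPolynomial.C c) *
        MvPolynomial.X 1), ?_, ?_⟩
      · simp only [map_mul, map_neg, map_sub, MvPolynomial.aeval_X, MvPolynomial.aeval_C,
          ← hf1]
        simp
        ring
      · have h : (LaurentPolynomial.C X * T 1 * T (-1) : LaurentPolynomial (Polynomial K)) =
            LaurentPolynomial.C X := by rw [mul_assoc, hT]; simp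
        simp only [map_mul, map_neg, map_sub, Fin.zero_eta, hX0, hX1, hY0, hf2,
          MvPolynomial.algHom_C, hC, h]
        ring
    · refine ⟨N + 1, f', ?_, ?_⟩
      · simp only [map_mul, MvPolynomial.aeval_X, ← hf1]
        simp
        field_simp
        ring
      · simp only [map_mul, Fin.mk_one, hY1, hf2]
        rw [mul_comm (blowUpHom c f), ← mul_assoc, hT]
        push_cast
        congr 2
        ring

theorem diagHom_eq_blowUpHom {u v : F}
    (huv : Function.Injective (MvPolynomial.aeval ![u, v] : MvPolynomial (Fin 2) K →ₐ[K] F))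
    (hv : v ≠ 0) {c : K} {J H : MvPolynomial (Fin 2) K}
    (h : MvPolynomial.aeval ![-(u * v - algebraMap K F c) * v, 1 / v] H =
      MvPolynomial.aeval ![u, v] J) :
    diagHom K J = blowUpHom c H := by
  obtain ⟨N, H', h1, h2⟩ := exists_clear_denominator (u := u) hv c H
  have h3 : MvPolynomial.X 1 ^ N * J = H' := huv (by
    rw [← h1, h, map_mul, map_pow, MvPolynomial.aeval_X]
    simp)
  rw [← h3, map_mul, map_pow, diagHom, MvPolynomial.aeval_X] at h2
  simp only [Matrix.cons_val_one, Matrix.cons_val_fin_one, LaurentPolynomial.T_pow, mul_neg,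
    mul_one] at h2
  exact (LaurentPolynomial.isUnit_T (-N : ℤ)).mul_left_cancel h2

/-- A polynomial in `u`, `v` that is regular in the chart `x = -(u v - c) v`, `y = v⁻¹` has
diagonals divisible by powers of `X - c`. -/
theorem dvd_diag_of_blowUp {u v : F}
    (huv : Function.Injective (MvPolynomial.aeval ![u, v] : MvPolynomial (Fin 2) K →ₐ[K] F))
    (hv : v ≠ 0) {c : K} {J H : MvPolynomial (Fin 2) K}
    (h : MvPolynomial.aeval ![-(u * v - algebraMap K F c) * v, 1 / v] H =
      MvPolynomial.aeval ![u, v] J) (w : ℕ) :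
    (X - C c) ^ w ∣ diag w J := by
  rw [diag, diagHom_eq_blowUpHom huv hv h]
  exact dvd_coeff_blowUpHom c w H

/-- Two blow-ups in succession: `J` is a polynomial `H` in the chart `x = -(u v - c) v`, `y = v⁻¹`,
and `H` is again regular in the blow-up of the exchanged pair `(y, x)` at `c'`. -/
theorem dvd_diag_of_blowUp_blowUp {u v : F}
    (huv : Function.Injective (MvPolynomial.aeval ![u, v] : MvPolynomial (Fin 2) K →ₐ[K] F))
    (hv : v ≠ 0) {c c' : K} {J H : MvPolynomial (Fin 2) K}
    (h : MvPolynomial.aeval ![-(u * v - algebraMap K F c) * v, 1 / v] H =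
      MvPolynomial.aeval ![u, v] J) (w : ℕ)
    (h' : (X - C c') ^ w ∣ diag w (MvPolynomial.rename (Equiv.swap 0 1) H)) :
    ((X - C c) * (X - C (c - c'))) ^ w ∣ diag w J := by
  rw [diag, diagHom_eq_blowUpHom huv hv h, coeff_blowUpHom_eq_comp]
  obtain ⟨e, he⟩ := h'
  rw [he]
  refine ⟨e.comp (C c - X), ?_⟩
  simp only [Polynomial.mul_comp, Polynomial.pow_comp, Polynomial.X_comp, Polynomial.sub_comp,
    Polynomial.C_comp, ← mul_assoc, ← mul_pow]
  congr 2
  rw [Polynomial.C_sub]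
  ring

end BlowUp

/-! ### Polynomials of degree at most `15` with divisible diagonals -/

namespace Polynomial

variable {K : Type*} [Field K]

theorem eq_zero_of_monic_dvd_of_coeff {D g : K[X]} {d : ℕ} (hd : D.natDegree = d)
    (hD : D.Monic) (hdvd : D ∣ g) (h : ∀ a, d ≤ a → g.coeff a = 0) : g = 0 := by
  refine eq_zero_of_dvd_of_degree_lt hdvd ?_
  rw [degree_eq_natDegree hD.ne_zero, hd]
  exact (degree_lt_iff_coeff_zero g d).2 h

theorem eq_C_mul_of_monic_dvd_of_coeff {D g : K[X]} {d : ℕ} (hd : D.natDegree = d)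
    (hD : D.Monic) (hdvd : D ∣ g) (h : ∀ a, d < a → g.coeff a = 0) : g = C (g.coeff d) * D := by
  refine sub_eq_zero.1 (eq_zero_of_monic_dvd_of_coeff hd hD
    (dvd_sub hdvd (dvd_mul_left D _)) fun a ha => ?_)
  rw [coeff_sub, coeff_C_mul]
  rcases ha.eq_or_lt with rfl | ha
  · rw [← hd, hD.coeff_natDegree]
    ring
  · have h1 : D.coeff a = 0 := coeff_eq_zero_of_natDegree_lt (by omega)
    rw [h a ha, h1, mul_zero, sub_zero]

/-- A polynomial with a zero of order `l` at `0`, a zero of order `r` at `1` and degree less than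
`l + r` vanishes. -/
theorem eq_zero_of_coeff_of_coeff_taylor {f : K[X]} (l r : ℕ) (h0 : ∀ a, a < l → f.coeff a = 0)
    (h1 : ∀ a, a < r → (taylor 1 f).coeff a = 0) (h2 : ∀ a, l + r ≤ a → f.coeff a = 0) :
    f = 0 := by
  have hX : X ^ l ∣ f := X_pow_dvd_iff.2 h0
  have hX1 : (X - C 1) ^ r ∣ f := by
    obtain ⟨g, hg⟩ := X_pow_dvd_iff.2 h1
    refine ⟨taylor (-1) g, ?_⟩
    have h3 := congrArg (taylor (-1)) hg
    rw [taylor_taylor, neg_add_cancel, taylor_zero, taylor_mul, taylor_X_pow] at h3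
    rw [h3, C_neg, sub_eq_add_neg]
  have hcop : IsCoprime (X ^ l : K[X]) ((X - C 1) ^ r) := by
    refine IsCoprime.pow ⟨1, -1, ?_⟩
    rw [C_1]
    ring
  refine eq_zero_of_monic_dvd_of_coeff (d := l + r) ?_
    ((monic_X_pow l).mul ((monic_X_sub_C (1 : K)).pow r)) (hcop.mul_dvd hX hX1) h2
  rw [(monic_X_pow l).natDegree_mul ((monic_X_sub_C (1 : K)).pow r), natDegree_X_pow,
    natDegree_pow, natDegree_X_sub_C, mul_one]

end Polynomial

section Admissible

open Polynomial (X C taylor)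

variable {K : Type*} [Field K]

/-- The coefficient of `vᵇ`, as a polynomial in `u`. -/
noncomputable def row (b : ℕ) (f : MvPolynomial (Fin 2) K) : Polynomial K :=
  (MvPolynomial.aeval ![C X, X] f : Polynomial (Polynomial K)).coeff b

/-- The substitution `u ↦ u + 1`. -/
noncomputable def shift (K : Type*) [Field K] :
    MvPolynomial (Fin 2) K →ₐ[K] MvPolynomial (Fin 2) K :=
  MvPolynomial.aeval ![MvPolynomial.X 0 + 1, MvPolynomial.X 1]

theorem coeff_row (a b : ℕ) (f : MvPolynomial (Fin 2) K) :
    (row b f).coeff a = coeffAt f a b := by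
  induction f using MvPolynomial.induction_on' with
  | monomial m r =>
    rw [row, MvPolynomial.aeval_monomial, Finsupp.prod_fintype _ _ (by simp), Fin.prod_univ_two,
      coeffAt_monomial]
    have : (algebraMap K (Polynomial (Polynomial K))) r = C (C r) := rfl
    simp only [Matrix.cons_val_zero, Matrix.cons_val_one, Matrix.cons_val_fin_one, this,
      ← mul_assoc]
    rw [← map_pow, ← map_mul, Polynomial.coeff_C_mul_X_pow,
      apply_ite (fun P : Polynomial K => P.coeff a), Polynomial.coeff_C_mul_X_pow,
      Polynomial.coeff_zero]
    split_ifs <;> first | rfl | (exfalso; omega)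
  | add f g hf hg =>
    rw [row, map_add, Polynomial.coeff_add, Polynomial.coeff_add]
    exact congrArg₂ (· + ·) hf hg

theorem row_shift (b : ℕ) (f : MvPolynomial (Fin 2) K) : row b (shift K f) = taylor 1 (row b f) := by
  have h : (MvPolynomial.aeval ![C X, X] : _ →ₐ[K] Polynomial (Polynomial K)).comp (shift K) =
      (Polynomial.mapAlgHom (Polynomial.taylorAlgHom (1 : K))).comp
        (MvPolynomial.aeval ![C X, X]) := by
    refine MvPolynomial.algHom_ext fun i => ?_
    fin_cases i <;> simp [shift]
  have h1 := congrArg (fun P : Polynomial (Polynomial K) => P.coeff b) (DFunLike.congr_fun h f)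
  simpa [row] using h1

theorem coeffAt_rename_swap (f : MvPolynomial (Fin 2) K) (a b : ℕ) :
    coeffAt (MvPolynomial.rename (Equiv.swap 0 1) f) a b = coeffAt f b a := by
  rw [coeffAt, coeffAt, ← MvPolynomial.coeff_rename_mapDomain (Equiv.swap (0 : Fin 2) 1)
    (Equiv.injective _) f]
  congr 1
  simp [Finsupp.mapDomain_add, Finsupp.mapDomain_single, add_comm]

/-- The conditions on a polynomial `J` of degree at most `15` in `q`, `p` that come from the blow-ups
at `p = ∞`, `q = 0` (through `P`), at `q = ∞`, `p = 0` (through `A`) and at `p = ∞`, `q = 1`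
(through `B`). -/
structure IsAdmissible (P A B : Polynomial K) (J : MvPolynomial (Fin 2) K) : Prop where
  totalDegree_le : J.totalDegree ≤ 15
  dvd_diag : ∀ w, P ^ w ∣ diag w J
  dvd_diag_swap : ∀ w, A ^ w ∣ diag w (MvPolynomial.rename (Equiv.swap 0 1) J)
  dvd_diag_shift : ∀ w, B ^ w ∣ diag w (shift K J)

namespace IsAdmissible

variable {P A B : Polynomial K} {J : MvPolynomial (Fin 2) K}

theorem coeffAt_of_lt (h : IsAdmissible P A B J) {a b : ℕ} (hab : 15 < a + b) :
    coeffAt J a b = 0 :=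
  coeffAt_eq_zero_of_totalDegree_lt (h.totalDegree_le.trans_lt hab)

theorem coeff_taylor_row_of_lt (h : IsAdmissible P A B J) {a b : ℕ} (hab : 15 < a + b) :
    (taylor 1 (row b J)).coeff a = 0 := by
  by_cases h0 : row b J = 0
  · simp [h0]
  refine Polynomial.coeff_eq_zero_of_natDegree_lt ?_
  rw [Polynomial.natDegree_taylor]
  by_contra! h1
  refine Polynomial.leadingCoeff_ne_zero.2 h0 ?_
  rw [Polynomial.leadingCoeff, coeff_row]
  exact h.coeffAt_of_lt (by omega)

theorem coeffAt_diag_eq_zero (h : IsAdmissible P A B J) (hP : P.Monic) (hP5 : P.natDegree = 5)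
    (w : ℕ) (h0 : ∀ a, 5 * w ≤ a → coeffAt J a (a + w) = 0) (a : ℕ) :
    coeffAt J a (a + w) = 0 := by
  rw [← coeff_diag, Polynomial.eq_zero_of_monic_dvd_of_coeff (d := 5 * w) _ (hP.pow w)
    (h.dvd_diag w), Polynomial.coeff_zero]
  · intro a ha
    rw [coeff_diag, h0 a ha]
  · rw [hP.natDegree_pow, hP5, mul_comm]

theorem coeffAt_codiag_eq_zero (h : IsAdmissible P A B J) (hA : A.Monic) (hA2 : A.natDegree = 2)
    (w : ℕ) (h0 : ∀ b, 2 * w ≤ b → coeffAt J (b + w) b = 0) (b : ℕ) :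
    coeffAt J (b + w) b = 0 := by
  rw [← coeffAt_rename_swap, ← coeff_diag,
    Polynomial.eq_zero_of_monic_dvd_of_coeff (d := 2 * w) _ (hA.pow w)
    (h.dvd_diag_swap w), Polynomial.coeff_zero]
  · intro a ha
    rw [coeff_diag, coeffAt_rename_swap, h0 a ha]
  · rw [hA.natDegree_pow, hA2, mul_comm]

theorem coeff_taylor_eq_zero (h : IsAdmissible P A B J) (hB : B.Monic) (hB2 : B.natDegree = 2)
    (w : ℕ) (h0 : ∀ a, 2 * w ≤ a → (taylor 1 (row (a + w) J)).coeff a = 0) (a : ℕ) :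
    (taylor 1 (row (a + w) J)).coeff a = 0 := by
  rw [← row_shift, coeff_row, ← coeff_diag,
    Polynomial.eq_zero_of_monic_dvd_of_coeff (d := 2 * w) _ (hB.pow w)
    (h.dvd_diag_shift w), Polynomial.coeff_zero]
  · intro a ha
    rw [coeff_diag, ← coeff_row, row_shift, h0 a ha]
  · rw [hB.natDegree_pow, hB2, mul_comm]

end IsAdmissible

/-- `P` is monic of degree `5`, the number of points blown up at `p = ∞`, `q = 0`; `A` and `B` are
monic of degree `2`. -/
structure IsBlowUpData (P A B : Polynomial K) : Prop where
  monic_P : P.Monic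
  natDegree_P : P.natDegree = 5
  monic_A : A.Monic
  natDegree_A : A.natDegree = 2
  monic_B : B.Monic
  natDegree_B : B.natDegree = 2

namespace IsAdmissible

variable {P A B : Polynomial K} {J : MvPolynomial (Fin 2) K}

theorem coeffAt_eq_zero_of_add_two_le (h : IsAdmissible P A B J) (hD : IsBlowUpData P A B)
    {a b : ℕ} (hab : a + 2 ≤ b) : coeffAt J a b = 0 := by
  obtain ⟨w, rfl⟩ := Nat.exists_eq_add_of_le (show a ≤ b by omega)
  exact h.coeffAt_diag_eq_zero hD.monic_P hD.natDegree_P w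
    (fun a' ha' => h.coeffAt_of_lt (by omega)) a

theorem coeffAt_eq_zero_of_add_four_le (h : IsAdmissible P A B J) (hD : IsBlowUpData P A B)
    {a b : ℕ} (hab : b + 4 ≤ a) : coeffAt J a b = 0 := by
  obtain ⟨w, rfl⟩ := Nat.exists_eq_add_of_le (show b ≤ a by omega)
  exact h.coeffAt_codiag_eq_zero hD.monic_A hD.natDegree_A w
    (fun a' ha' => h.coeffAt_of_lt (by omega)) b

theorem coeff_taylor_eq_zero_of_add_three_le (h : IsAdmissible P A B J)
    (hD : IsBlowUpData P A B) {a b : ℕ} (hab : a + 3 ≤ b) :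
    (taylor 1 (row b J)).coeff a = 0 := by
  obtain ⟨w, rfl⟩ := Nat.exists_eq_add_of_le (show a ≤ b by omega)
  refine h.coeff_taylor_eq_zero hD.monic_B hD.natDegree_B w (fun a' ha' => ?_) a
  by_cases h1 : 15 < a' + (a' + w)
  · exact h.coeff_taylor_row_of_lt h1
  -- Only `a' = 6`, `w = 3` is left, and the ninth row is zero.
  have h2 : row (a' + w) J = 0 := by
    ext k
    rw [coeff_row, Polynomial.coeff_zero]
    by_cases hk : k + 2 ≤ a' + w
    · exact h.coeffAt_eq_zero_of_add_two_le hD hk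
    · exact h.coeffAt_of_lt (by omega)
  rw [h2, map_zero, Polynomial.coeff_zero]

theorem row_eq_zero (h : IsAdmissible P A B J) {b : ℕ} (l r : ℕ)
    (h0 : ∀ a, a < l → coeffAt J a b = 0) (h1 : ∀ a, a < r → (taylor 1 (row b J)).coeff a = 0)
    (h2 : ∀ a, l + r ≤ a → a + b ≤ 15 → coeffAt J a b = 0) : row b J = 0 := by
  refine Polynomial.eq_zero_of_coeff_of_coeff_taylor l r (fun a ha => ?_) h1 fun a ha => ?_
  · rw [coeff_row, h0 a ha]
  · rw [coeff_row]
    by_cases hab : a + b ≤ 15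
    · exact h2 a ha hab
    · exact h.coeffAt_of_lt (by omega)

theorem row_eq_zero_of_seven_le (h : IsAdmissible P A B J) (hD : IsBlowUpData P A B) {b : ℕ}
    (hb : 7 ≤ b) : row b J = 0 :=
  h.row_eq_zero (b - 1) (b - 2)
    (fun a ha => h.coeffAt_eq_zero_of_add_two_le hD (by omega))
    (fun a ha => h.coeff_taylor_eq_zero_of_add_three_le hD (by omega))
    (fun a ha hab => by omega)

theorem coeffAt_eq_zero_of_row {a b : ℕ} (h : row b J = 0) : coeffAt J a b = 0 := by
  rw [← coeff_row, h, Polynomial.coeff_zero]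

/-- An admissible polynomial without the monomial `q⁹ p⁶` is constant: going down the powers of
`p`, each row has too many zeros at `q = 0` and `q = 1` for its degree. -/
theorem eq_C (h : IsAdmissible P A B J) (hD : IsBlowUpData P A B) (h96 : coeffAt J 9 6 = 0) :
    J = MvPolynomial.C (coeffAt J 0 0) := by
  have hlow : ∀ {a b}, a + 2 ≤ b → coeffAt J a b = 0 :=
    fun hab => h.coeffAt_eq_zero_of_add_two_le hD hab
  have hone : ∀ {a b}, a + 3 ≤ b → (taylor 1 (row b J)).coeff a = 0 :=
    fun hab => h.coeff_taylor_eq_zero_of_add_three_le hD hab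
  have h7 : ∀ {a b}, 7 ≤ b → coeffAt J a b = 0 :=
    fun hb => coeffAt_eq_zero_of_row (h.row_eq_zero_of_seven_le hD hb)
  -- On the diagonal `a = b + 3` the divisor has degree `6`, and `q⁹ p⁶` is its only possible
  -- monomial of that height.
  have hhigh3 : ∀ {a b}, b + 3 ≤ a → coeffAt J a b = 0 := fun {a b} hab => by
    by_cases h4 : b + 4 ≤ a
    · exact h.coeffAt_eq_zero_of_add_four_le hD h4
    obtain rfl : a = b + 3 := by omega
    refine h.coeffAt_codiag_eq_zero hD.monic_A hD.natDegree_A 3 (fun b' hb' => ?_) b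
    rcases hb'.eq_or_lt with rfl | hb'
    · exact h96
    · exact h7 (by omega)
  have r6 : row 6 J = 0 := h.row_eq_zero 5 4 (fun a ha => hlow (by omega))
    (fun a ha => hone (by omega)) (fun a ha _ => hhigh3 (by omega))
  have h6 : ∀ {a b}, 6 ≤ b → coeffAt J a b = 0 := fun {a b} hb => by
    rcases hb.eq_or_lt with rfl | hb
    · exact coeffAt_eq_zero_of_row r6
    · exact h7 hb
  have hlow1 : ∀ {a b}, a + 1 ≤ b → coeffAt J a b = 0 := fun {a b} hab => by
    by_cases h2 : a + 2 ≤ b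
    · exact hlow h2
    obtain rfl : b = a + 1 := by omega
    exact h.coeffAt_diag_eq_zero hD.monic_P hD.natDegree_P 1 (fun a' _ => h6 (by omega)) a
  have r5 : row 5 J = 0 := h.row_eq_zero 5 3 (fun a ha => hlow1 (by omega))
    (fun a ha => hone (by omega)) (fun a ha _ => hhigh3 (by omega))
  have rowge6 : ∀ {b}, 6 ≤ b → row b J = 0 := fun {b} hb => by
    ext a
    rw [coeff_row, h6 hb, Polynomial.coeff_zero]
  have hone2 : ∀ {a b}, a + 2 ≤ b → (taylor 1 (row b J)).coeff a = 0 := fun {a b} hab => by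
    by_cases h3 : a + 3 ≤ b
    · exact hone h3
    obtain rfl : b = a + 2 := by omega
    refine h.coeff_taylor_eq_zero hD.monic_B hD.natDegree_B 2 (fun a' ha' => ?_) a
    rw [rowge6 (by omega), map_zero, Polynomial.coeff_zero]
  have r4 : row 4 J = 0 := h.row_eq_zero 4 3 (fun a ha => hlow1 (by omega))
    (fun a ha => hone2 (by omega)) (fun a ha _ => hhigh3 (by omega))
  have row4 : ∀ {b}, 4 ≤ b → row b J = 0 := fun {b} hb => by
    rcases hb.eq_or_lt with rfl | hb
    · exact r4
    rcases (Nat.succ_le_of_lt hb).eq_or_lt with rfl | hb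
    · exact r5
    · exact rowge6 hb
  have hhigh2 : ∀ {a b}, b + 2 ≤ a → coeffAt J a b = 0 := fun {a b} hab => by
    by_cases h3 : b + 3 ≤ a
    · exact hhigh3 h3
    obtain rfl : a = b + 2 := by omega
    exact h.coeffAt_codiag_eq_zero hD.monic_A hD.natDegree_A 2
      (fun b' hb' => coeffAt_eq_zero_of_row (row4 (by omega))) b
  have r3 : row 3 J = 0 := h.row_eq_zero 3 2 (fun a ha => hlow1 (by omega))
    (fun a ha => hone2 (by omega)) (fun a ha _ => hhigh2 (by omega))
  have row3 : ∀ {b}, 3 ≤ b → row b J = 0 := fun {b} hb => by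
    rcases hb.eq_or_lt with rfl | hb
    · exact r3
    · exact row4 hb
  have hone1 : ∀ {a b}, a + 1 ≤ b → (taylor 1 (row b J)).coeff a = 0 := fun {a b} hab => by
    by_cases h2 : a + 2 ≤ b
    · exact hone2 h2
    obtain rfl : b = a + 1 := by omega
    refine h.coeff_taylor_eq_zero hD.monic_B hD.natDegree_B 1 (fun a' ha' => ?_) a
    rw [row3 (by omega), map_zero, Polynomial.coeff_zero]
  have r2 : row 2 J = 0 := h.row_eq_zero 2 2 (fun a ha => hlow1 (by omega))
    (fun a ha => hone1 (by omega)) (fun a ha _ => hhigh2 (by omega))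
  have row2 : ∀ {b}, 2 ≤ b → row b J = 0 := fun {b} hb => by
    rcases hb.eq_or_lt with rfl | hb
    · exact r2
    · exact row3 hb
  have hhigh1 : ∀ {a b}, b + 1 ≤ a → coeffAt J a b = 0 := fun {a b} hab => by
    by_cases h2 : b + 2 ≤ a
    · exact hhigh2 h2
    obtain rfl : a = b + 1 := by omega
    exact h.coeffAt_codiag_eq_zero hD.monic_A hD.natDegree_A 1
      (fun b' hb' => coeffAt_eq_zero_of_row (row2 (by omega))) b
  have r1 : row 1 J = 0 := h.row_eq_zero 1 1 (fun a ha => hlow1 (by omega))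
    (fun a ha => hone1 (by omega)) (fun a ha _ => hhigh1 (by omega))
  ext m
  have hm : coeffAt J (m 0) (m 1) = MvPolynomial.coeff m J :=
    congrArg (fun m => MvPolynomial.coeff m J) ((exponent_eq_iff m _ _).2 ⟨rfl, rfl⟩).symm
  rw [MvPolynomial.coeff_C, ← hm]
  split_ifs with h0
  · rw [← h0]
    rfl
  by_cases hm1 : m 1 = 0
  · refine hhigh1 ?_
    by_contra h1
    refine h0 (((exponent_eq_iff m 0 0).2 ⟨by omega, hm1⟩).trans ?_).symm
    simp
  · by_cases hm2 : m 1 = 1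
    · rw [hm2]
      exact coeffAt_eq_zero_of_row r1
    · exact coeffAt_eq_zero_of_row (row2 (by omega))

/-- The coefficient of `q⁹ p⁶` determines the rows of `p⁶` and `p⁵`; for the latter the conditions
are overdetermined, which forces a linear relation between the three blow-ups. -/
theorem coeffAt_mul_eq_zero (h : IsAdmissible P A B J) (hD : IsBlowUpData P A B) :
    coeffAt J 9 6 * (3 * A.nextCoeff - P.nextCoeff - 2 * B.nextCoeff) = 0 := by
  set c := coeffAt J 9 6 with hc
  have hlow : ∀ {a b}, a + 2 ≤ b → coeffAt J a b = 0 :=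
    fun hab => h.coeffAt_eq_zero_of_add_two_le hD hab
  have hhigh : ∀ {a b}, b + 4 ≤ a → coeffAt J a b = 0 :=
    fun hab => h.coeffAt_eq_zero_of_add_four_le hD hab
  have hone : ∀ {a b}, a + 3 ≤ b → (taylor 1 (row b J)).coeff a = 0 :=
    fun hab => h.coeff_taylor_eq_zero_of_add_three_le hD hab
  have row7 : ∀ {b}, 7 ≤ b → row b J = 0 := fun hb => h.row_eq_zero_of_seven_le hD hb
  have nextCoeff_pow : ∀ {Q : Polynomial K} {k d : ℕ}, Q.Monic → (Q ^ k).natDegree = d + 1 →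
      (Q ^ k).coeff d = k * Q.nextCoeff := fun {Q k d} hQ hk => by
    rw [← nsmul_eq_mul, ← hQ.nextCoeff_pow, Polynomial.nextCoeff_of_natDegree_pos (by omega), hk]
    rfl
  -- Expansions of the rows at `q = 1`.
  have taylor_row : ∀ (l r : ℕ) (g : Polynomial K),
      taylor 1 (X ^ l * (X - C 1) ^ r * g) = X ^ r * ((X + C 1) ^ l * taylor 1 g) := by
    intro l r g
    rw [Polynomial.taylor_mul, Polynomial.taylor_mul, Polynomial.taylor_X_pow,
      Polynomial.taylor_pow, map_sub, Polynomial.taylor_X, Polynomial.taylor_C]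
    ring
  -- Degree at most `9`, a zero of order `5` at `0` and one of order `4` at `1`.
  have row6 : row 6 J = X ^ 5 * (X - C 1) ^ 4 * C c := by
    refine sub_eq_zero.1 (Polynomial.eq_zero_of_coeff_of_coeff_taylor 5 4 ?_ ?_ ?_)
    · intro a ha
      rw [Polynomial.coeff_sub, coeff_row, hlow (by omega), mul_assoc, Polynomial.coeff_X_pow_mul',
        if_neg (by omega), sub_zero]
    · intro a ha
      rw [map_sub, Polynomial.coeff_sub, hone (by omega), taylor_row, Polynomial.coeff_X_pow_mul',
        if_neg (by omega), sub_zero]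
    · intro a ha
      rw [Polynomial.coeff_sub, coeff_row, mul_assoc, Polynomial.coeff_X_pow_mul',
        if_pos (by omega), Polynomial.coeff_mul_C]
      rcases ha.eq_or_lt with rfl | ha
      · have : ((X - C 1 : Polynomial K) ^ 4).coeff 4 = 1 := by
          have h1 := ((Polynomial.monic_X_sub_C (1 : K)).pow 4).coeff_natDegree
          rwa [Polynomial.natDegree_pow, Polynomial.natDegree_X_sub_C] at h1
        rw [show 5 + 4 - 5 = 4 from rfl, this, one_mul, ← hc, sub_self]
      · rw [hhigh (by omega), Polynomial.coeff_eq_zero_of_natDegree_lt, zero_mul, sub_zero]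
        rw [Polynomial.natDegree_pow, Polynomial.natDegree_X_sub_C]
        omega
  set l₀ := -coeffAt J 4 5 with hl₀
  set l₁ := coeffAt J 8 5 with hl₁
  -- Degree at most `8`, a zero of order `4` at `0` and one of order `3` at `1`: two coefficients are
  -- left, but three of the diagonals prescribe one of `l₀`, `l₁`, `l₀ + l₁` each.
  have row5 : row 5 J = X ^ 4 * (X - C 1) ^ 3 * (C l₀ + C l₁ * X) := by
    have hexp : (X - C 1 : Polynomial K) ^ 3 * (C l₀ + C l₁ * X) =
        C (-l₀) + C (3 * l₀ - l₁) * X + C (3 * l₁ - 3 * l₀) * X ^ 2 + C (l₀ - 3 * l₁) * X ^ 3 +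
          C l₁ * X ^ 4 := by
      simp only [map_neg, map_sub, map_mul, Polynomial.C_ofNat, map_one]
      ring
    refine sub_eq_zero.1 (Polynomial.eq_zero_of_coeff_of_coeff_taylor 5 3 ?_ ?_ ?_)
    · intro a ha
      rw [Polynomial.coeff_sub, coeff_row, mul_assoc, Polynomial.coeff_X_pow_mul']
      rcases (Nat.le_of_lt_succ ha).eq_or_lt with rfl | ha
      · rw [if_pos le_rfl, hexp]
        simp [Polynomial.coeff_X, Polynomial.coeff_X_pow, hl₀]
      · rw [hlow (by omega), if_neg (by omega), sub_zero]
    · intro a ha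
      rw [map_sub, Polynomial.coeff_sub, hone (by omega), taylor_row, Polynomial.coeff_X_pow_mul',
        if_neg (by omega), sub_zero]
    · intro a ha
      rw [Polynomial.coeff_sub, coeff_row, mul_assoc, Polynomial.coeff_X_pow_mul',
        if_pos (by omega), hexp]
      rcases ha.eq_or_lt with rfl | ha
      · simp only [Polynomial.coeff_add, Polynomial.coeff_C_mul, Polynomial.coeff_X,
          Polynomial.coeff_X_pow, Polynomial.coeff_C]
        norm_num [hl₁]
      · rw [hhigh (by omega)]
        simp only [Polynomial.coeff_add, Polynomial.coeff_C_mul, Polynomial.coeff_X,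
          Polynomial.coeff_X_pow, Polynomial.coeff_C]
        rw [if_neg (by omega), if_neg (by omega), if_neg (by omega), if_neg (by omega),
          if_neg (by omega)]
        ring
  have e56 : coeffAt J 5 6 = c := by
    rw [← coeff_row, row6, mul_assoc, Polynomial.coeff_X_pow_mul', if_pos le_rfl,
      Polynomial.coeff_mul_C, Polynomial.coeff_zero_eq_eval_zero]
    norm_num
  have eP : coeffAt J 4 5 = c * P.nextCoeff := by
    have h1 := Polynomial.eq_C_mul_of_monic_dvd_of_coeff (d := 5)
      (by rw [pow_one, hD.natDegree_P]) (hD.monic_P.pow 1) (h.dvd_diag 1) (fun a ha => by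
        rw [coeff_diag]
        exact coeffAt_eq_zero_of_row (row7 (by omega)))
    have h2 := congrArg (fun Q : Polynomial K => Q.coeff 4) h1
    simp only [Polynomial.coeff_C_mul] at h2
    rw [nextCoeff_pow hD.monic_P (by rw [pow_one, hD.natDegree_P]), coeff_diag, coeff_diag, e56,
      Nat.cast_one, one_mul] at h2
    exact h2
  have eA : l₁ = c * (3 * A.nextCoeff) := by
    have hdeg : (A ^ 3).natDegree = 6 := by rw [hD.monic_A.natDegree_pow, hD.natDegree_A]
    have h1 := Polynomial.eq_C_mul_of_monic_dvd_of_coeff (d := 6) hdeg (hD.monic_A.pow 3)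
      (h.dvd_diag_swap 3) (fun a ha => by
        rw [coeff_diag, coeffAt_rename_swap]
        exact coeffAt_eq_zero_of_row (row7 (by omega)))
    have h2 := congrArg (fun Q : Polynomial K => Q.coeff 5) h1
    simp only [Polynomial.coeff_C_mul] at h2
    rw [nextCoeff_pow hD.monic_A hdeg, coeff_diag, coeff_diag, coeffAt_rename_swap,
      coeffAt_rename_swap] at h2
    exact h2
  have eB : l₀ + l₁ = c * (2 * B.nextCoeff) := by
    have hdeg : (B ^ 2).natDegree = 4 := by rw [hD.monic_B.natDegree_pow, hD.natDegree_B]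
    have h1 := Polynomial.eq_C_mul_of_monic_dvd_of_coeff (d := 4) hdeg (hD.monic_B.pow 2)
      (h.dvd_diag_shift 2) (fun a ha => by
        rw [coeff_diag, ← coeff_row, row_shift, row7 (by omega), map_zero, Polynomial.coeff_zero])
    have h2 := congrArg (fun Q : Polynomial K => Q.coeff 3) h1
    simp only [Polynomial.coeff_C_mul] at h2
    rw [nextCoeff_pow hD.monic_B hdeg, coeff_diag, coeff_diag, ← coeff_row, ← coeff_row,
      row_shift, row_shift, row6, row5, taylor_row, taylor_row, Polynomial.coeff_X_pow_mul',
      if_pos le_rfl, Polynomial.coeff_X_pow_mul', if_pos le_rfl,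
      Polynomial.coeff_zero_eq_eval_zero, Polynomial.coeff_zero_eq_eval_zero] at h2
    simpa using h2
  linear_combination -eA + eP + eB

end IsAdmissible

end Admissible

/-! ### The explicit Hamiltonian -/

theorem prod_sub_partialSums {A : Type*} [CommRing A] (α : Fin 9 → A) (z : A) :
    ∏ i, (z - partialSums α i) =
      z ^ 5 - elemSym α 1 * z ^ 4 + elemSym α 2 * z ^ 3 - elemSym α 3 * z ^ 2 + elemSym α 4 * z -
        elemSym α 5 := by
  have h := congrArg (Polynomial.eval z) (Multiset.prod_X_sub_X_eq_sum_esymm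
    ((Finset.univ : Finset (Fin 5)).val.map (partialSums α)))
  have h0 : elemSym α 0 = 1 := by simp [elemSym]
  have he : ∀ k, ((Finset.univ : Finset (Fin 5)).val.map (partialSums α)).esymm k = elemSym α k :=
    fun k => Finset.esymm_map_val _ _ _
  simp only [he, Multiset.card_map, Finset.card_val, Finset.card_univ, Fintype.card_fin,
    Finset.sum_range_succ, Finset.sum_range_zero, h0, Multiset.map_map] at h
  have h1 : ∏ i, (z - partialSums α i) = Polynomial.eval z
      ((Finset.univ : Finset (Fin 5)).val.map
        ((fun t => Polynomial.X - Polynomial.C t) ∘ partialSums α)).prod := by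
    rw [← Finset.prod_eq_multiset_prod, Polynomial.eval_prod]
    simp
  rw [h1, h]
  simp
  ring

theorem elemSym_one {A : Type*} [CommRing A] (α : Fin 9 → A) :
    elemSym α 1 = 5 * α 1 + 4 * α 2 + 3 * α 3 + 2 * α 4 + α 5 := by
  simp only [elemSym, Finset.powersetCard_one, Finset.sum_map, Function.Embedding.coeFn_mk,
    Finset.prod_singleton, Fin.sum_univ_five, partialSums]
  simp
  ring

theorem map_partialSums {A B : Type*} [CommRing A] [CommRing B] (f : A →+* B) (α : Fin 9 → A)
    (i : Fin 5) : f (partialSums α i) = partialSums (fun j => f (α j)) i := by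
  fin_cases i <;> simp [partialSums]

theorem map_elemSym {A B : Type*} [CommRing A] [CommRing B] (f : A →+* B) (α : Fin 9 → A)
    (k : ℕ) : f (elemSym α k) = elemSym (fun j => f (α j)) k := by
  simp only [elemSym, map_sum, map_prod, map_partialSums]

theorem map_e8Hamiltonian {A B : Type*} [CommRing A] [CommRing B] (f : A →+* B) (α : Fin 9 → A)
    (q p : A) : f (e8Hamiltonian α q p) = e8Hamiltonian (fun j => f (α j)) (f q) (f p) := by
  simp only [e8Hamiltonian, map_add, map_sub, map_mul, map_neg, map_pow, map_one, map_ofNat,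
    map_elemSym]

section Subring

variable {A : Type*} [CommRing A] {S : Subring A} {α : Fin 9 → A}

theorem partialSums_mem (hα : ∀ i, α i ∈ S) (j : Fin 5) : partialSums α j ∈ S := by
  have h1 := hα 1
  have h2 := S.add_mem h1 (hα 2)
  have h3 := S.add_mem h2 (hα 3)
  have h4 := S.add_mem h3 (hα 4)
  have h5 := S.add_mem h4 (hα 5)
  fin_cases j
  · exact h1
  · exact h2
  · exact h3
  · exact h4
  · exact h5

theorem elemSym_mem (hα : ∀ i, α i ∈ S) (k : ℕ) : elemSym α k ∈ S :=
  S.sum_mem fun _ _ => S.prod_mem fun j _ => partialSums_mem hα j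

/-- Arranged by the powers of `q` relative to `p`, the Hamiltonian is `p ∏ (z - cᵢ)` plus a
polynomial in `z = q p` and `q A(z)`, where `A = (z + α₀) (z + α₀ + α₈)`. -/
theorem e8Hamiltonian_mem_of_mem (hα : ∀ i, α i ∈ S)
    (hrel : elemSym α 1 + 3 * (2 * α 0 + α 8) + 2 * (2 * α 6 + α 7) = 0) {q p : A}
    (hz : q * p ∈ S) (hP : p * ∏ i, (q * p - partialSums α i) ∈ S)
    (hA : q * ((q * p + α 0) * (q * p + α 0 + α 8)) ∈ S) : e8Hamiltonian α q p ∈ S := by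
  have h2 := elemSym_mem hα 2
  have h3 := elemSym_mem hα 3
  have h4 := elemSym_mem hα 4
  have h5 := elemSym_mem hα 5
  have hσ : 2 * α 0 + α 8 ∈ S := S.add_mem (S.mul_mem (ofNat_mem S 2) (hα 0)) (hα 8)
  have hs : 2 * α 6 + α 7 ∈ S := S.add_mem (S.mul_mem (ofNat_mem S 2) (hα 6)) (hα 7)
  have hm : α 0 * (α 0 + α 8) ∈ S := S.mul_mem (hα 0) (S.add_mem (hα 0) (hα 8))
  have hn : α 6 * (α 6 + α 7) ∈ S := S.mul_mem (hα 6) (S.add_mem (hα 6) (hα 7))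
  have hA' : q * ((q * p + α 0) * (q * p + α 0 + α 8)) =
      q * ((q * p) ^ 2 + (2 * α 0 + α 8) * (q * p) + α 0 * (α 0 + α 8)) := by ring
  rw [hA'] at hA
  have h1 : elemSym α 1 = -(3 * (2 * α 0 + α 8) + 2 * (2 * α 6 + α 7)) := by
    linear_combination hrel
  rw [prod_sub_partialSums, h1] at hP
  clear hA' h1 hrel hα
  unfold e8Hamiltonian
  extract_lets σ m s n e₂ e₃ e₄ e₅ a b c d c₄₁ c₃₃ c₃₂ c₃₁ c₂₄ c₂₃ c₂₂ c₂₁ c₁₄ c₁₃ c₁₂ c₁₁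
  change p * ((q * p) ^ 5 - -(3 * σ + 2 * s) * (q * p) ^ 4 + e₂ * (q * p) ^ 3 - e₃ * (q * p) ^ 2 +
    e₄ * (q * p) - e₅) ∈ S at hP
  change q * ((q * p) ^ 2 + σ * (q * p) + m) ∈ S at hA
  change e₂ ∈ S at h2
  change e₃ ∈ S at h3
  change e₄ ∈ S at h4
  change e₅ ∈ S at h5
  change σ ∈ S at hσ
  change s ∈ S at hs
  change m ∈ S at hm
  change n ∈ S at hn
  clear_value σ m s n e₂ e₃ e₄ e₅
  set z := q * p with hzdef
  set x := q * (z ^ 2 + σ * z + m) with hx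
  set y := p * (z ^ 5 - -(3 * σ + 2 * s) * z ^ 4 + e₂ * z ^ 3 - e₃ * z ^ 2 + e₄ * z - e₅) with hy
  have key : y + (c₁₁ * z + c₂₁ * z ^ 2 + (e₃ - c₃₁) * z ^ 3 + (c₄₁ - 2 * e₂) * z ^ 4 -
      (12 * σ + 6 * s) * z ^ 5 - 4 * z ^ 6) +
      x * (b + c * z + d * z ^ 2 + (12 * σ + 6 * s) * z ^ 3 + 6 * z ^ 4) +
      x ^ 2 * (a - (4 * σ + 2 * s) * z - 4 * z ^ 2) + x ^ 3 ∈ S := by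
    subst c₁₁ c₁₂ c₁₃ c₁₄ c₂₁ c₂₂ c₂₃ c₂₄ c₃₁ c₃₂ c₃₃ c₄₁ a b c d
    clear_value x y z
    repeat' first
      | with_reducible assumption
      | with_reducible apply S.add_mem
      | with_reducible apply S.sub_mem
      | with_reducible apply S.mul_mem
      | with_reducible apply S.neg_mem
      | with_reducible apply S.pow_mem
      | exact ofNat_mem S _
  convert key using 1
  simp only [x, y, z]
  simp only [c₁₁, c₁₂, c₁₃, c₁₄, c₂₁, c₂₂, c₂₃, c₂₄, c₃₁, c₃₂, c₃₃, c₄₁, a, b, c, d]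
  ring

/-- Arranged by the powers of `u = q - 1` relative to `p`, the Hamiltonian is a polynomial in
`p B(u p)`, `u p` and `u`, where `B = (z - α₆) (z - α₆ - α₇)`. -/
theorem e8Hamiltonian_mem_of_shift_mem (hα : ∀ i, α i ∈ S) {q p : A} (hu : q - 1 ∈ S)
    (hz : (q - 1) * p ∈ S)
    (hB : p * (((q - 1) * p - α 6) * ((q - 1) * p - (α 6 + α 7))) ∈ S) :
    e8Hamiltonian α q p ∈ S := by
  have h2 := elemSym_mem hα 2
  have h3 := elemSym_mem hα 3
  have h4 := elemSym_mem hα 4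
  have h5 := elemSym_mem hα 5
  have hσ : 2 * α 0 + α 8 ∈ S := S.add_mem (S.mul_mem (ofNat_mem S 2) (hα 0)) (hα 8)
  have hs : 2 * α 6 + α 7 ∈ S := S.add_mem (S.mul_mem (ofNat_mem S 2) (hα 6)) (hα 7)
  have hm : α 0 * (α 0 + α 8) ∈ S := S.mul_mem (hα 0) (S.add_mem (hα 0) (hα 8))
  have hn : α 6 * (α 6 + α 7) ∈ S := S.mul_mem (hα 6) (S.add_mem (hα 6) (hα 7))
  have hq : q ∈ S := by
    have := S.add_mem hu S.one_mem
    rwa [sub_add_cancel] at this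
  have hB' : p * (((q - 1) * p - α 6) * ((q - 1) * p - (α 6 + α 7))) =
      p * (((q - 1) * p) ^ 2 - (2 * α 6 + α 7) * ((q - 1) * p) + α 6 * (α 6 + α 7)) := by ring
  rw [hB'] at hB
  clear hB' hα
  unfold e8Hamiltonian
  extract_lets σ m s n e₂ e₃ e₄ e₅ a b c d c₄₁ c₃₃ c₃₂ c₃₁ c₂₄ c₂₃ c₂₂ c₂₁ c₁₄ c₁₃ c₁₂ c₁₁
  change p * (((q - 1) * p) ^ 2 - s * ((q - 1) * p) + n) ∈ S at hB
  change e₂ ∈ S at h2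
  change e₃ ∈ S at h3
  change e₄ ∈ S at h4
  change e₅ ∈ S at h5
  change σ ∈ S at hσ
  change s ∈ S at hs
  change m ∈ S at hm
  change n ∈ S at hn
  clear_value σ m s n e₂ e₃ e₄ e₅
  set z := (q - 1) * p with hzdef
  set x := p * (z ^ 2 - s * z + n) with hx
  have h1 : (1 : A) ∈ S := S.one_mem
  -- `τₖ` is the quotient of `qᵏ` by `(q - 1) ^ 2`.
  obtain ⟨τ₃, hτ₃⟩ : ∃ τ, τ = q + 2 := ⟨_, rfl⟩
  obtain ⟨τ₄, hτ₄⟩ : ∃ τ, τ = q ^ 2 + 2 * q + 3 := ⟨_, rfl⟩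
  obtain ⟨τ₅, hτ₅⟩ : ∃ τ, τ = q ^ 3 + 2 * q ^ 2 + 3 * q + 4 := ⟨_, rfl⟩
  have key : x ^ 2 + x * (5 * σ ^ 3 + 9 * σ ^ 2 * s + 5 * σ * s ^ 2 + σ * n - 2 * σ * e₂ - m * s +
        s ^ 3 - s * e₂ - e₃ + (3 * σ ^ 2 + 3 * σ * s + 3 * m + s ^ 2 + 3 * n - e₂) * z +
        (3 * σ - 3 * s) * z ^ 2 + 5 * z ^ 3) +
      (z ^ 6 * τ₅ + z ^ 5 * (-(3 * σ + 2 * s) * τ₄ + 3 * σ * τ₅) +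
        z ^ 4 * (e₂ * τ₃ + c₄₁ * τ₄ + 3 * (σ ^ 2 + m) * τ₅) +
        z ^ 3 * (e₃ + c₃₁ * τ₃ + c₃₂ * τ₄ + c₃₃ * τ₅) +
        z ^ 2 * (c₂₁ + c₂₂ * τ₃ + c₂₃ * τ₄ + c₂₄ * τ₅) +
        z * (c₁₁ + c₁₂ * (q + 1) + c₁₃ * (q ^ 2 + q + 1) + c₁₄ * (q ^ 3 + q ^ 2 + q + 1)) +
        q * m * (b + a * m * q + m ^ 2 * q ^ 2)) ∈ S := by
    subst c₁₁ c₁₂ c₁₃ c₁₄ c₂₁ c₂₂ c₂₃ c₂₄ c₃₁ c₃₂ c₃₃ c₄₁ a b c d τ₃ τ₄ τ₅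
    clear_value x z
    repeat' first
      | with_reducible assumption
      | with_reducible apply S.add_mem
      | with_reducible apply S.sub_mem
      | with_reducible apply S.mul_mem
      | with_reducible apply S.neg_mem
      | with_reducible apply S.pow_mem
      | exact ofNat_mem S _
  convert key using 1
  simp only [x, z, hτ₃, hτ₄, hτ₅]
  simp only [c₁₁, c₁₂, c₁₃, c₁₄, c₂₁, c₂₂, c₂₃, c₂₄, c₃₁, c₃₂, c₃₃, c₄₁, a, b, c, d]
  ring

end Subring

/-- The leading term of the Hamiltonian is `q⁹ p⁶`. -/
theorem exists_e8Hamiltonian_eq_add {K : Type*} [Field K] (α : Fin 9 → K) :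
    ∃ R : MvPolynomial (Fin 2) K, R.totalDegree ≤ 14 ∧
      e8Hamiltonian (fun i => MvPolynomial.C (α i)) (MvPolynomial.X 0) (MvPolynomial.X 1) =
        MvPolynomial.X 0 ^ 9 * MvPolynomial.X 1 ^ 6 + R := by
  set S : Subring (MvPolynomial (Fin 2) K) := (MvPolynomial.C (σ := Fin 2) (R := K)).range with hS
  have hα : ∀ i, (fun i => (MvPolynomial.C (α i) : MvPolynomial (Fin 2) K)) i ∈ S :=
    fun i => ⟨α i, rfl⟩
  generalize (fun i => (MvPolynomial.C (α i) : MvPolynomial (Fin 2) K)) = γ at hα ⊢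
  have h0 := hα 0
  have h6 := hα 6
  have h7 := hα 7
  have h8 := hα 8
  have h2 := elemSym_mem hα 2
  have h3 := elemSym_mem hα 3
  have h4 := elemSym_mem hα 4
  have h5 := elemSym_mem hα 5
  have hone : (1 : MvPolynomial (Fin 2) K) ∈ S := S.one_mem
  have hq : (MvPolynomial.X 0 : MvPolynomial (Fin 2) K).totalDegree ≤ 1 :=
    (MvPolynomial.totalDegree_X _).le
  have hp : (MvPolynomial.X 1 : MvPolynomial (Fin 2) K).totalDegree ≤ 1 :=
    (MvPolynomial.totalDegree_X _).le
  generalize (MvPolynomial.X 0 : MvPolynomial (Fin 2) K) = q at *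
  generalize (MvPolynomial.X 1 : MvPolynomial (Fin 2) K) = p at *
  have con : ∀ {f : MvPolynomial (Fin 2) K}, f ∈ S → f.totalDegree ≤ 0 := by
    rintro _ ⟨r, rfl⟩
    rw [MvPolynomial.totalDegree_C]
  have mul : ∀ {f g : MvPolynomial (Fin 2) K} {k l : ℕ}, f.totalDegree ≤ k → g.totalDegree ≤ l →
      (f * g).totalDegree ≤ k + l := fun hf hg =>
    (MvPolynomial.totalDegree_mul _ _).trans (add_le_add hf hg)
  have add : ∀ {f g : MvPolynomial (Fin 2) K} {k l : ℕ}, f.totalDegree ≤ k → g.totalDegree ≤ l →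
      (f + g).totalDegree ≤ max k l := fun hf hg =>
    (MvPolynomial.totalDegree_add _ _).trans (max_le_max hf hg)
  have pow : ∀ {f : MvPolynomial (Fin 2) K} {k : ℕ}, f.totalDegree ≤ k → ∀ l : ℕ,
      (f ^ l).totalDegree ≤ l * k := fun hf l =>
    (MvPolynomial.totalDegree_pow _ _).trans (Nat.mul_le_mul_left _ hf)
  have hu : (q - 1).totalDegree ≤ 1 := by
    rw [sub_eq_add_neg]
    exact add hq (con (S.neg_mem hone))
  have num : ∀ k : ℕ, (k : MvPolynomial (Fin 2) K) ∈ S := fun k => natCast_mem S k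
  unfold e8Hamiltonian
  extract_lets σ m s n e₂ e₃ e₄ e₅ a b c d c₄₁ c₃₃ c₃₂ c₃₁ c₂₄ c₂₃ c₂₂ c₂₁ c₁₄ c₁₃ c₁₂ c₁₁
  have hcoeff : (-(3 * σ + 2 * s) ∈ S ∧ 3 * σ ∈ S ∧ e₂ ∈ S ∧ c₄₁ ∈ S ∧ 3 * (σ ^ 2 + m) ∈ S) ∧
      (e₃ ∈ S ∧ c₃₁ ∈ S ∧ c₃₂ ∈ S ∧ c₃₃ ∈ S) ∧ (e₄ ∈ S ∧ c₂₁ ∈ S ∧ c₂₂ ∈ S ∧ c₂₃ ∈ S ∧ c₂₄ ∈ S) ∧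
      (-e₅ ∈ S ∧ c₁₁ ∈ S ∧ c₁₂ ∈ S ∧ c₁₃ ∈ S ∧ c₁₄ ∈ S) ∧
      (m ∈ S ∧ b ∈ S ∧ a * m ∈ S ∧ m ^ 2 ∈ S) := by
    have hσ : σ ∈ S := S.add_mem (S.mul_mem (ofNat_mem S 2) h0) h8
    have hs : s ∈ S := S.add_mem (S.mul_mem (ofNat_mem S 2) h6) h7
    have hm : m ∈ S := S.mul_mem h0 (S.add_mem h0 h8)
    have hn : n ∈ S := S.mul_mem h6 (S.add_mem h6 h7)
    change e₂ ∈ S at h2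
    change e₃ ∈ S at h3
    change e₄ ∈ S at h4
    change e₅ ∈ S at h5
    clear_value σ m s n e₂ e₃ e₄ e₅ S
    subst c₁₁ c₁₂ c₁₃ c₁₄ c₂₁ c₂₂ c₂₃ c₂₄ c₃₁ c₃₂ c₃₃ c₄₁ a b c d
    refine ⟨⟨?_, ?_, ?_, ?_, ?_⟩, ⟨?_, ?_, ?_, ?_⟩, ⟨?_, ?_, ?_, ?_, ?_⟩, ⟨?_, ?_, ?_, ?_, ?_⟩,
      ?_, ?_, ?_, ?_⟩
    all_goals
      repeat' first
        | with_reducible assumption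
        | with_reducible apply S.add_mem
        | with_reducible apply S.sub_mem
        | with_reducible apply S.mul_mem
        | with_reducible apply S.neg_mem
        | with_reducible apply S.pow_mem
        | exact ofNat_mem S _
  obtain ⟨⟨k₁, k₂, k₃, k₄, k₅⟩, ⟨k₆, k₇, k₈, k₉⟩, ⟨l₁, l₂, l₃, l₄, l₅⟩, ⟨l₆, l₇, l₈, l₉, l₀⟩,
    j₁, j₂, j₃, j₄⟩ := hcoeff
  clear_value c₁₁ c₁₂ c₁₃ c₁₄ c₂₁ c₂₂ c₂₃ c₂₄ c₃₁ c₃₂ c₃₃ c₄₁ a b c d σ m s n e₂ e₃ e₄ e₅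
  have t₆ := mul (mul (pow hp 6) (pow hq 5)) (add (add (add (mul (con (S.neg_mem (num 4)))
    (pow hq 3)) (mul (con (num 6)) (pow hq 2))) (mul (con (S.neg_mem (num 4))) hq)) (con hone))
  have t₅ := mul (mul (mul (pow hp 5) (pow hu 3)) (pow hq 4)) (add (con k₁) (mul (con k₂) hq))
  have t₄ := mul (mul (mul (pow hp 4) (pow hu 2)) (pow hq 3))
    (add (add (con k₃) (mul (con k₄) hq)) (mul (con k₅) (pow hq 2)))
  have t₃ := mul (mul (mul (pow hp 3) hu) (pow hq 2))
    (add (add (add (con k₆) (mul (con k₇) hq)) (mul (con k₈) (pow hq 2))) (mul (con k₉) (pow hq 3)))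
  have t₂ := mul (mul (pow hp 2) hq) (add (add (add (add (con l₁) (mul (con l₂) hq))
    (mul (con l₃) (pow hq 2))) (mul (con l₄) (pow hq 3))) (mul (con l₅) (pow hq 4)))
  have t₁ := mul hp (add (add (add (add (con l₆) (mul (con l₇) hq))
    (mul (con l₈) (pow hq 2))) (mul (con l₉) (pow hq 3))) (mul (con l₀) (pow hq 4)))
  have t₀ := mul (mul hq (con j₁)) (add (add (con j₂) (mul (con j₃) hq)) (mul (con j₄) (pow hq 2)))
  refine ⟨_, (add (add (add (add (add (add t₆ t₅) t₄) t₃) t₂) t₁) t₀).trans (by decide), ?_⟩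
  push_cast
  ring

/-! ### The nine charts -/

namespace PhaseField

open MvPolynomial (aeval)
open Polynomial (X C)

theorem aeval_q_p (I : PhasePoly) : aeval ![q, p] I = algebraMap PhasePoly PhaseField I := by
  have h : (aeval ![q, p] : PhasePoly →ₐ[RatFunc ℂ] PhaseField) =
      IsScalarTower.toAlgHom (RatFunc ℂ) PhasePoly PhaseField := by
    refine MvPolynomial.algHom_ext fun i => ?_
    fin_cases i <;> simp [q, p]
  exact DFunLike.congr_fun h I

theorem aeval_rename_swap (x y : PhaseField) (H : PhasePoly) :
    aeval ![x, y] (MvPolynomial.rename (Equiv.swap 0 1) H) = aeval ![y, x] H := by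
  have h : ![x, y] ∘ Equiv.swap (0 : Fin 2) 1 = ![y, x] := by
    funext i
    fin_cases i <;> simp
  rw [MvPolynomial.aeval_rename, h]

theorem aeval_shift (x y : PhaseField) (H : PhasePoly) :
    aeval ![x - 1, y] (shift (RatFunc ℂ) H) = aeval ![x, y] H := by
  have h : (aeval ![x - 1, y] : PhasePoly →ₐ[RatFunc ℂ] PhaseField).comp (shift (RatFunc ℂ)) =
      aeval ![x, y] := by
    refine MvPolynomial.algHom_ext fun i => ?_
    fin_cases i <;> simp [shift]
  exact DFunLike.congr_fun h H

theorem p_ne_zero : p ≠ 0 := ne_zero_of_bracket_ne_zero (x := q) (by simp [bracket_q_p])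

theorem q_ne_zero : q ≠ 0 :=
  ne_zero_of_bracket_ne_zero (x := p) (by simp [bracket_swap q p, bracket_q_p])

theorem bracket_q_sub_one_p : bracket (q - 1) p = 1 := by
  refine Eq.trans ?_ bracket_q_p
  simp only [bracket, map_sub, Derivation.map_one_eq_zero, sub_zero]

/-- `r₀` is, up to the order of the coordinates, the blow-up chart of the pair `(p, q)`. -/
theorem chartZero_eq (α : Fin 9 → ℂ) :
    chartZero α = ((blowUpChart (p, q) (-α 0)).2, (blowUpChart (p, q) (-α 0)).1) := by
  have : const (-α 0) = -const (α 0) := by simp only [const, map_neg]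
  simp only [chartZero, blowUpChart, this, Prod.mk.injEq, true_and]
  ring

theorem bracket_chartZero (α : Fin 9 → ℂ) : bracket (chartZero α).1 (chartZero α).2 = 1 := by
  rw [chartZero_eq, bracket_swap, bracket_blowUpChart q_ne_zero, ← bracket_swap, bracket_q_p]

theorem chartZero_snd_ne_zero (α : Fin 9 → ℂ) : (chartZero α).2 ≠ 0 :=
  ne_zero_of_bracket_ne_zero (x := (chartZero α).1) (by simp [bracket_chartZero])

theorem bracket_chart (α : Fin 9 → ℂ) (j : Fin 9) :
    bracket (chart α j).1 (chart α j).2 = 1 := by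
  have h (c : ℂ) := (bracket_blowUpChart (u := q) p_ne_zero c).trans bracket_q_p
  have h' (c : ℂ) := (bracket_blowUpChart (u := q - 1) p_ne_zero c).trans bracket_q_sub_one_p
  fin_cases j
  · exact bracket_chartZero α
  · exact h _
  · exact h _
  · exact h _
  · exact h _
  · exact h _
  · exact h' _
  · exact h' _
  · exact (bracket_blowUpChart (u := (chartZero α).1) (chartZero_snd_ne_zero α) _).trans
      (bracket_chartZero α)

/-- The polynomials in the coordinates of a chart. -/
noncomputable def regularFunctions (xy : PhaseField × PhaseField) :
    Subalgebra (RatFunc ℂ) PhaseField :=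
  (aeval ![xy.1, xy.2] : PhasePoly →ₐ[RatFunc ℂ] PhaseField).range

theorem fst_mem_regularFunctions (xy : PhaseField × PhaseField) : xy.1 ∈ regularFunctions xy :=
  ⟨MvPolynomial.X 0, by simp⟩

theorem snd_mem_regularFunctions (xy : PhaseField × PhaseField) : xy.2 ∈ regularFunctions xy :=
  ⟨MvPolynomial.X 1, by simp⟩

theorem const_mem_regularFunctions (xy : PhaseField × PhaseField) (c : ℂ) :
    const c ∈ regularFunctions xy :=
  (regularFunctions xy).algebraMap_mem _

theorem isPolynomialHamiltonianIn_chart_iff (α : Fin 9 → ℂ) (j : Fin 9) (I : PhasePoly) :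
    IsPolynomialHamiltonianIn I (chart α j) ↔
      algebraMap PhasePoly PhaseField I ∈ regularFunctions (chart α j) :=
  isPolynomialHamiltonianIn_iff (bracket_chart α j) I

/-- The charts `r₁, …, r₅`, indexed like `partialSums`. -/
theorem chart_succ (α : Fin 9 → ℂ) (i : Fin 5) :
    ∃ j, chart α j = blowUpChart (q, p) (partialSums α i) := by
  fin_cases i
  exacts [⟨1, rfl⟩, ⟨2, rfl⟩, ⟨3, rfl⟩, ⟨4, rfl⟩, ⟨5, rfl⟩]

/-! ### Regularity in the charts as divisibility -/

/-- `∏ (X - cᵢ)` for the partial sums `cᵢ`. -/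
noncomputable def polyP (α : Fin 9 → ℂ) : Polynomial (RatFunc ℂ) :=
  ∏ i, (X - C (RatFunc.C (partialSums α i)))

/-- `(X + α₀) (X + α₀ + α₈)`. -/
noncomputable def polyA (α : Fin 9 → ℂ) : Polynomial (RatFunc ℂ) :=
  (X - C (RatFunc.C (-α 0))) * (X - C (RatFunc.C (-α 0) - RatFunc.C (α 8)))

/-- `(X - α₆) (X - α₆ - α₇)`. -/
noncomputable def polyB (α : Fin 9 → ℂ) : Polynomial (RatFunc ℂ) :=
  (X - C (RatFunc.C (α 6))) * (X - C (RatFunc.C (α 6 + α 7)))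

theorem isBlowUpData (α : Fin 9 → ℂ) : IsBlowUpData (polyP α) (polyA α) (polyB α) where
  monic_P := Polynomial.monic_prod_X_sub_C _ _
  natDegree_P := by
    rw [polyP, Polynomial.natDegree_prod_of_monic _ _ fun i _ => Polynomial.monic_X_sub_C _]
    simp
  monic_A := (Polynomial.monic_X_sub_C _).mul (Polynomial.monic_X_sub_C _)
  natDegree_A := by
    rw [polyA, (Polynomial.monic_X_sub_C _).natDegree_mul (Polynomial.monic_X_sub_C _),
      Polynomial.natDegree_X_sub_C, Polynomial.natDegree_X_sub_C]
  monic_B := (Polynomial.monic_X_sub_C _).mul (Polynomial.monic_X_sub_C _)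
  natDegree_B := by
    rw [polyB, (Polynomial.monic_X_sub_C _).natDegree_mul (Polynomial.monic_X_sub_C _),
      Polynomial.natDegree_X_sub_C, Polynomial.natDegree_X_sub_C]

theorem three_mul_nextCoeff_polyA_sub (α : Fin 9 → ℂ) :
    3 * (polyA α).nextCoeff - (polyP α).nextCoeff - 2 * (polyB α).nextCoeff =
      RatFunc.C (6 * α 0 + 5 * α 1 + 4 * α 2 + 3 * α 3 + 2 * α 4 + α 5 + 4 * α 6 + 2 * α 7 +
        3 * α 8) := by
  rw [polyA, polyP, polyB, Polynomial.prod_X_sub_C_nextCoeff,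
    (Polynomial.monic_X_sub_C _).nextCoeff_mul (Polynomial.monic_X_sub_C _),
    (Polynomial.monic_X_sub_C _).nextCoeff_mul (Polynomial.monic_X_sub_C _)]
  simp only [Polynomial.nextCoeff_X_sub_C, Fin.sum_univ_five, partialSums]
  simp only [Matrix.cons_val, map_add, map_mul, map_neg, map_ofNat]
  ring

/-- A polynomial of degree at most `15` that is regular in all nine charts is admissible. The
assumptions on the parameters make the linear factors of `P` and `B` coprime. -/
theorem isAdmissible {α : Fin 9 → ℂ} (hα : Function.Injective (partialSums α)) (hα₇ : α 7 ≠ 0)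
    {I : PhasePoly} (hI : I.totalDegree ≤ 15)
    (h : ∀ j, algebraMap PhasePoly PhaseField I ∈ regularFunctions (chart α j)) :
    IsAdmissible (polyP α) (polyA α) (polyB α) I where
  totalDegree_le := hI
  dvd_diag w := by
    rw [polyP, ← Finset.prod_pow]
    refine Finset.prod_dvd_of_coprime (fun i _ j _ hij => ?_) fun i _ => ?_
    · exact (Polynomial.pairwise_coprime_X_sub_C
        (((RatFunc.C : ℂ →+* RatFunc ℂ).injective).comp hα) hij).pow
    · obtain ⟨j, hj⟩ := chart_succ α i
      obtain ⟨H, hH⟩ := hj ▸ h j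
      refine dvd_diag_of_blowUp (F := PhaseField) (u := q) (v := p)
        (aeval_injective_of_bracket_ne_zero (by simp [bracket_q_p])) p_ne_zero (H := H) ?_ w
      rw [aeval_q_p]
      exact hH
  dvd_diag_swap w := by
    obtain ⟨H₀, h₀⟩ := h 0
    obtain ⟨H₈, h₈⟩ := h 8
    rw [← h₀] at h₈
    have key := chartZero_eq α
    refine dvd_diag_of_blowUp_blowUp (F := PhaseField) (u := p) (v := q)
      (aeval_injective_of_bracket_ne_zero (by simp [bracket_swap q p, bracket_q_p])) q_ne_zero
      (H := MvPolynomial.rename (Equiv.swap 0 1) H₀) ?_ w ?_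
    · rw [aeval_rename_swap, aeval_rename_swap, aeval_q_p]
      refine Eq.trans ?_ h₀
      change _ = aeval ![(chartZero α).1, (chartZero α).2] H₀
      rw [key]
      rfl
    · have hswap : MvPolynomial.rename (Equiv.swap (0 : Fin 2) 1)
          (MvPolynomial.rename (Equiv.swap (0 : Fin 2) 1) H₀) = H₀ := by
        rw [MvPolynomial.rename_rename, ← Equiv.coe_trans, Equiv.swap_swap, Equiv.coe_refl,
          MvPolynomial.rename_id_apply]
      rw [hswap]
      exact dvd_diag_of_blowUp (F := PhaseField) (u := (chartZero α).1) (v := (chartZero α).2)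
        (aeval_injective_of_bracket_ne_zero (by simp [bracket_chartZero]))
        (chartZero_snd_ne_zero α) (H := H₈) h₈ w
  dvd_diag_shift w := by
    have hdvd : ∀ {c : ℂ}, algebraMap PhasePoly PhaseField I ∈
        regularFunctions (blowUpChart (q - 1, p) c) →
        (X - C (RatFunc.C c)) ^ w ∣ diag w (shift (RatFunc ℂ) I) := by
      rintro c ⟨H, hH⟩
      refine dvd_diag_of_blowUp (F := PhaseField) (u := q - 1) (v := p)
        (aeval_injective_of_bracket_ne_zero (by simp [bracket_q_sub_one_p])) p_ne_zero
        (H := H) ?_ w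
      rw [aeval_shift, aeval_q_p]
      exact hH
    rw [polyB, mul_pow]
    refine IsCoprime.mul_dvd (IsCoprime.pow ?_) (hdvd (h 6)) (hdvd (h 7))
    refine Polynomial.isCoprime_X_sub_C_of_isUnit_sub (Ne.isUnit fun h0 => hα₇ ?_)
    rw [← map_sub, map_eq_zero] at h0
    linear_combination -h0

/-! ### Regularity of the explicit Hamiltonian -/

theorem e8Hamiltonian_mem_regularFunctions {α : Fin 9 → ℂ}
    (hrel : 6 * α 0 + 5 * α 1 + 4 * α 2 + 3 * α 3 + 2 * α 4 + α 5 + 4 * α 6 + 2 * α 7 +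
      3 * α 8 = 0) (j : Fin 9) :
    e8Hamiltonian (fun i => const (α i)) q p ∈ regularFunctions (chart α j) := by
  set γ : Fin 9 → PhaseField := fun i => const (α i) with hγ
  let constHom : ℂ →+* PhaseField := (algebraMap (RatFunc ℂ) PhaseField).comp RatFunc.C
  have hγrel : elemSym γ 1 + 3 * (2 * γ 0 + γ 8) + 2 * (2 * γ 6 + γ 7) = 0 := by
    have h := congrArg constHom hrel
    simp only [map_add, map_mul, map_ofNat, map_zero] at h
    change 6 * γ 0 + 5 * γ 1 + 4 * γ 2 + 3 * γ 3 + 2 * γ 4 + γ 5 + 4 * γ 6 + 2 * γ 7 + 3 * γ 8 = 0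
      at h
    rw [elemSym_one]
    linear_combination h
  have hps : ∀ i, partialSums γ i = const (partialSums α i) := fun i =>
    (map_partialSums constHom α i).symm
  have hp0 := p_ne_zero
  have hq0 := q_ne_zero
  set S := regularFunctions (chart α j) with hS
  have hγS : ∀ i, γ i ∈ S.toSubring := fun i => const_mem_regularFunctions _ _
  have hpsS : ∀ i, partialSums γ i ∈ S := partialSums_mem hγS
  have hx := fst_mem_regularFunctions (chart α j)
  have hy := snd_mem_regularFunctions (chart α j)
  rw [← hS] at hx hy
  have main : ∀ i, chart α j = blowUpChart (q, p) (partialSums α i) →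
      e8Hamiltonian γ q p ∈ S := fun i hi => by
    rw [hi] at hx hy
    simp only [blowUpChart, ← hps] at hx hy
    have hz : q * p ∈ S := by
      have h := S.sub_mem (hpsS i) (S.mul_mem hx hy)
      convert h using 1
      field_simp
      ring
    have hq : q ∈ S := by
      have h := S.mul_mem hz hy
      convert h using 1
      field_simp
    refine e8Hamiltonian_mem_of_mem (S := S.toSubring) hγS hγrel hz ?_
      (S.mul_mem hq (S.mul_mem (S.add_mem hz (hγS 0))
        (S.add_mem (S.add_mem hz (hγS 0)) (hγS 8))))
    have h := S.mul_mem (S.neg_mem hx) (S.prod_mem (t := Finset.univ.erase i)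
      (f := fun k => q * p - partialSums γ k) fun k _ => S.sub_mem hz (hpsS k))
    rw [← Finset.mul_prod_erase _ _ (Finset.mem_univ i)]
    change _ ∈ S
    convert h using 1
    ring
  have shifted : ∀ c c' : ℂ, chart α j = blowUpChart (q - 1, p) c →
      p * (((q - 1) * p - γ 6) * ((q - 1) * p - (γ 6 + γ 7))) =
        p * (((q - 1) * p - const c) * ((q - 1) * p - const c')) →
      e8Hamiltonian γ q p ∈ S := fun c c' hc hB => by
    have hcS : const c ∈ S := const_mem_regularFunctions _ _
    have hcS' : const c' ∈ S := const_mem_regularFunctions _ _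
    rw [hc] at hx hy
    simp only [blowUpChart] at hx hy
    have hz : (q - 1) * p ∈ S := by
      have h := S.sub_mem hcS (S.mul_mem hx hy)
      convert h using 1
      field_simp
      ring
    have hu : q - 1 ∈ S := by
      have h := S.mul_mem hz hy
      convert h using 1
      field_simp
    refine e8Hamiltonian_mem_of_shift_mem (S := S.toSubring) hγS hu hz ?_
    rw [hB]
    change _ ∈ S
    have h := S.mul_mem (S.neg_mem hx) (S.sub_mem hz hcS')
    convert h using 1
    ring
  have hP : q * p ∈ S → p ∈ S → p * ∏ i, (q * p - partialSums γ i) ∈ S := fun hz hp =>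
    S.mul_mem hp (S.prod_mem fun i _ => S.sub_mem hz (hpsS i))
  have hconst : const (α 6 + α 7) = γ 6 + γ 7 := constHom.map_add _ _
  clear_value S
  fin_cases j
  · change 1 / q ∈ S at hx
    change -(q * p + γ 0) * q ∈ S at hy
    have hz : q * p ∈ S := by
      have h := S.sub_mem (S.neg_mem (S.mul_mem hx hy)) (hγS 0)
      convert h using 1
      field_simp
      ring
    have hp : p ∈ S := by
      have h := S.mul_mem hz hx
      convert h using 1
      field_simp
    refine e8Hamiltonian_mem_of_mem (S := S.toSubring) hγS hγrel hz (hP hz hp) ?_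
    change _ ∈ S
    have h := S.mul_mem (S.neg_mem hy) (S.add_mem (S.add_mem hz (hγS 0)) (hγS 8))
    convert h using 1
    ring
  · exact main 0 rfl
  · exact main 1 rfl
  · exact main 2 rfl
  · exact main 3 rfl
  · exact main 4 rfl
  · exact shifted (α 6) (α 6 + α 7) rfl (by rw [hconst])
  · exact shifted (α 6 + α 7) (α 6) rfl (by rw [hconst]; ring)
  · have hy0 : -(q * p + γ 0) * q ≠ 0 := chartZero_snd_ne_zero α
    change -(1 / q * (-(q * p + γ 0) * q) - γ 8) * (-(q * p + γ 0) * q) ∈ S at hx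
    change 1 / (-(q * p + γ 0) * q) ∈ S at hy
    have hxy : 1 / q * (-(q * p + γ 0) * q) = -(q * p + γ 0) := by field_simp
    rw [hxy] at hx
    have hw : q * p + γ 0 ≠ 0 := fun h0 => hy0 (by rw [h0]; ring)
    have hz : q * p ∈ S := by
      have h := S.sub_mem (S.sub_mem (S.mul_mem hx hy) (hγS 8)) (hγS 0)
      convert h using 1
      field_simp
      ring
    have hq' : 1 / q ∈ S := by
      have h := S.mul_mem (S.neg_mem (S.add_mem hz (hγS 0))) hy
      convert h using 1
      field_simp
    have hp : p ∈ S := by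
      have h := S.mul_mem hz hq'
      convert h using 1
      field_simp
    refine e8Hamiltonian_mem_of_mem (S := S.toSubring) hγS hγrel hz (hP hz hp) ?_
    change _ ∈ S
    have h := S.neg_mem hx
    convert h using 1
    ring

end PhaseField

/-! ### The leading coefficient, and the classification -/

namespace PhaseField

/-- The explicit Hamiltonian as a polynomial. -/
noncomputable def e8Poly (α : Fin 9 → ℂ) : PhasePoly :=
  e8Hamiltonian (fun i => MvPolynomial.C (RatFunc.C (α i))) (MvPolynomial.X 0) (MvPolynomial.X 1)

theorem algebraMap_e8Poly (α : Fin 9 → ℂ) :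
    algebraMap PhasePoly PhaseField (e8Poly α) = e8Hamiltonian (fun i => const (α i)) q p := by
  rw [e8Poly, map_e8Hamiltonian]
  simp only [← algebraMap_eq]
  rfl

theorem totalDegree_e8Poly_le (α : Fin 9 → ℂ) : (e8Poly α).totalDegree ≤ 15 := by
  obtain ⟨R, hR, h⟩ := exists_e8Hamiltonian_eq_add fun i => (RatFunc.C (α i) : RatFunc ℂ)
  rw [e8Poly, h]
  refine (MvPolynomial.totalDegree_add _ _).trans (max_le ?_ (hR.trans (by decide)))
  refine (MvPolynomial.totalDegree_mul _ _).trans ?_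
  rw [MvPolynomial.totalDegree_X_pow, MvPolynomial.totalDegree_X_pow]

theorem coeffAt_e8Poly (α : Fin 9 → ℂ) : coeffAt (e8Poly α) 9 6 = 1 := by
  obtain ⟨R, hR, h⟩ := exists_e8Hamiltonian_eq_add fun i => (RatFunc.C (α i) : RatFunc ℂ)
  have hR0 : coeffAt R 9 6 = 0 := coeffAt_eq_zero_of_totalDegree_lt (hR.trans_lt (by decide))
  rw [coeffAt] at hR0
  rw [e8Poly, h, coeffAt, MvPolynomial.coeff_add, MvPolynomial.X_pow_eq_monomial,
    MvPolynomial.X_pow_eq_monomial, MvPolynomial.monomial_mul, one_mul,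
    MvPolynomial.coeff_monomial, if_pos rfl, hR0, add_zero]

theorem coeffAt_C_mul_e8Poly_add (α : Fin 9 → ℂ) (c d : RatFunc ℂ) :
    coeffAt (MvPolynomial.C c * e8Poly α + MvPolynomial.C d) 9 6 = c := by
  have h0 : (0 : Fin 2 →₀ ℕ) ≠ Finsupp.single 0 9 + Finsupp.single 1 6 := fun h => by
    simpa using DFunLike.congr_fun h 0
  have h1 := coeffAt_e8Poly α
  rw [coeffAt] at h1 ⊢
  rw [MvPolynomial.coeff_add, MvPolynomial.coeff_C_mul, h1, MvPolynomial.coeff_C, if_neg h0,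
    mul_one, add_zero]

theorem totalDegree_C_mul_e8Poly_add_le (α : Fin 9 → ℂ) (c d : RatFunc ℂ) :
    (MvPolynomial.C c * e8Poly α + MvPolynomial.C d).totalDegree ≤ 15 := by
  refine (MvPolynomial.totalDegree_add _ _).trans (max_le ?_ ?_)
  · refine (MvPolynomial.totalDegree_mul _ _).trans ?_
    rw [MvPolynomial.totalDegree_C, zero_add]
    exact totalDegree_e8Poly_le α
  · rw [MvPolynomial.totalDegree_C]
    exact Nat.zero_le _

end PhaseField

open PhaseField in
theorem theorem11p1 (α : Fin 9 → ℂ) (hα : Function.Injective (partialSums α)) (hα₇ : α 7 ≠ 0)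
    (I : PhasePoly) :
    (I.totalDegree = 15 ∧
      ∀ j : Fin 9, PhaseField.IsPolynomialHamiltonianIn I (PhaseField.chart α j)) ↔
    (6 * α 0 + 5 * α 1 + 4 * α 2 + 3 * α 3 + 2 * α 4 + α 5 + 4 * α 6 + 2 * α 7 + 3 * α 8 = 0 ∧
      ∃ c d : RatFunc ℂ, c ≠ 0 ∧
        I = MvPolynomial.C c *
            e8Hamiltonian (fun i => MvPolynomial.C (RatFunc.C (α i)))
              (MvPolynomial.X 0) (MvPolynomial.X 1) +
          MvPolynomial.C d) := by
  have hD := isBlowUpData α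
  have regular : 6 * α 0 + 5 * α 1 + 4 * α 2 + 3 * α 3 + 2 * α 4 + α 5 + 4 * α 6 + 2 * α 7 +
      3 * α 8 = 0 → ∀ (c d : RatFunc ℂ) (j : Fin 9), algebraMap PhasePoly PhaseField
        (MvPolynomial.C c * e8Poly α + MvPolynomial.C d) ∈ regularFunctions (chart α j) := by
    intro hrel c d j
    rw [map_add, map_mul, ← algebraMap_eq, ← algebraMap_eq, algebraMap_e8Poly]
    exact add_mem (mul_mem (Subalgebra.algebraMap_mem _ _)
      (e8Hamiltonian_mem_regularFunctions hrel j)) (Subalgebra.algebraMap_mem _ _)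
  simp only [isPolynomialHamiltonianIn_chart_iff]
  constructor
  · rintro ⟨hdeg, hI⟩
    have hadm := isAdmissible hα hα₇ hdeg.le hI
    set c := coeffAt I 9 6 with hc
    have hc0 : c ≠ 0 := fun h0 => by
      have h1 := congrArg MvPolynomial.totalDegree (hadm.eq_C hD h0)
      rw [MvPolynomial.totalDegree_C, hdeg] at h1
      omega
    have hrel := (mul_eq_zero.1 (hadm.coeffAt_mul_eq_zero hD)).resolve_left hc0
    rw [three_mul_nextCoeff_polyA_sub, map_eq_zero] at hrel
    refine ⟨hrel, c, coeffAt (I - MvPolynomial.C c * e8Poly α) 0 0, hc0, ?_⟩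
    have hcE : MvPolynomial.C c * e8Poly α =
        MvPolynomial.C c * e8Poly α + MvPolynomial.C 0 := by rw [map_zero, add_zero]
    have hadm' : IsAdmissible (polyP α) (polyA α) (polyB α)
        (I - MvPolynomial.C c * e8Poly α) := by
      refine isAdmissible hα hα₇ ?_ fun j => ?_
      · refine (MvPolynomial.totalDegree_sub _ _).trans (max_le hdeg.le ?_)
        rw [hcE]
        exact totalDegree_C_mul_e8Poly_add_le α c 0
      · rw [map_sub, hcE]
        exact sub_mem (hI j) (regular hrel c 0 j)
    have h96 : coeffAt (I - MvPolynomial.C c * e8Poly α) 9 6 = 0 := by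
      have h1 := coeffAt_C_mul_e8Poly_add α c 0
      rw [← hcE, coeffAt] at h1
      rw [coeffAt, MvPolynomial.coeff_sub, h1, hc, coeffAt, sub_self]
    rw [← hadm'.eq_C hD h96]
    change I = MvPolynomial.C c * e8Poly α + (I - MvPolynomial.C c * e8Poly α)
    ring
  · rintro ⟨hrel, c, d, hc, rfl⟩
    change MvPolynomial.totalDegree (MvPolynomial.C c * e8Poly α + MvPolynomial.C d) = 15 ∧ _
    refine ⟨le_antisymm (totalDegree_C_mul_e8Poly_add_le α c d) ?_, regular hrel c d⟩
    by_contra! h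
    exact hc ((coeffAt_C_mul_e8Poly_add α c d).symm.trans (coeffAt_eq_zero_of_totalDegree_lt h))
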